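/- **Theorem (The First Discrete Adiabatic Theorem).** Let $T\ge 1$ be an integer, let $H$ be a complex Hilbert space, and let $W_T(s)$, $s\in\{0,1/T,\dots,1\}$, be unitary operators on $H$ (the walk operators). For a function $f$ of the discrete time $s$ let $Df(s)=f(s+1/T)-f(s)$ and $D^{(k)}=D\circ D^{(k-1)}$, $D^{(1)}=D$. Assume the following. * (Differences.) For $k=1,2$ the numbers $c_k(s)$ satisfy $\|D^{(k)}W_T(s)\|\le c_k(s)/T^k$ for all discrete times $0\le s\le 1-k/T$. * (Multistep gaps.) The spectrum of $W_T(s)$ is a union $\sigma_P(s)\cup\sigma_Q(s)$, and for $k=0,1,2$ and every discrete time $0\le s\le 1-k/T$ there are two disjoint closed arcs $\sigma^{(k)}_P(s)\supseteq\bigcup_{l=0}^k\sigma_P(s+l/T)$ and $\sigma^{(k)}_Q(s)\supseteq\bigcup_{l=0}^k\sigma_Q(s+l/T)$ of the unit circle, and $\Delta_k(s)$ is the minimum angular distance between these two arcs. * $T\ge \max_{s\in\{0,1/T,\dots,1-1/T\}} 2c_1(s)/\Delta_1(s)$. Let $U_T(s)=\prod_{l=0}^{sT-1}W_T(l/T)=W_T(s-1/T)\cdots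 W_T(1/T)W_T(0)$. Let $P_T(s)$ be the spectral projection of $W_T(s)$ onto $\sigma_P(s)$, $Q_T(s)=I-P_T(s)$, $S_T(s)=P_T(s+1/T)P_T(s)+Q_T(s+1/T)Q_T(s)$, $V_T(s)=\bigl(S_T(s)S_T(s)^\dagger\bigr)^{-1/2}S_T(s)$, and let the ideal adiabatic evolution be given by $U^A_T(0)=I$, $U^A_T(s+1/T)=V_T(s)W_T(s)U^A_T(s)$. Put $$\mathcal D_1(z)=\frac1{\sqrt{1-z^2}},\qquad \mathcal D_2(z)=\sqrt{\frac{1+z}{1-z}}-1,\qquad \mathcal D_3(z)=\frac{z}{(1-z^2)^{3/2}},$$ $$\mathcal G_{T,1}(s)=\frac{c_1(s)^2+c_1(s)c_1(s+1/T)}{\pi(1-\cos(\Delta_2(s)/2))}+\frac{2c_2(s)}{\Delta_2(s)},$$ $$\mathcal G_{T,2}(s)=\mathcal G_{T,1}(s)\,\mathcal D_3\!\left(\max\left(\frac{2c_1(s+1/T)}{T\Delta_1(s+1/T)},\frac{2c_1(s)}{T\Delta_1(s)}\right)\right),$$ $$\mathcal G_{T,3}(s)=\mathcal G_{T,2}(s)\left(1+\frac{2c_1(s)}{T\Delta_1(s)}\right)+\mathcal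 D_1\!\left(\frac{2c_1(s)}{T\Delta_1(s)}\right)\left(\mathcal G_{T,1}(s)+\frac{8c_1(s)^2}{\Delta_1(s)^2}\right),$$ $$\mathcal G_{T,4}(s)=\frac{\mathcal G_{T,3}(s)}{T}+c_1(s).$$ Then for every $s\in\{1/T,2/T,\dots,1\}$ such that $2c_1(m/T)/\Delta_1(m/T)\neq T$ for all $0\le m<sT$ (that is, such that no denominator below vanishes; otherwise the right-hand side is infinite), writing $n_\pm=n\pm1$, $$\begin{aligned} \|U_T(s)-U_T^A(s)\|\le{}&\frac{4}{\Delta_0(1/T)}\mathcal D_2\!\left(\frac{2c_1(0)}{T\Delta_1(0)}\right)+\frac{4}{\Delta_0(s)}\mathcal D_2\!\left(\frac{2c_1(s-1/T)}{T\Delta_1(s-1/T)}\right)+2\mathcal D_2\!\left(\frac{2c_1(s-1/T)}{T\Delta_1(s-1/T)}\right)\\ &+\sum_{n=1}^{sT-1}4\left(\frac1{\Delta_0(n_+/T)}+\frac2{\Delta_0(n/T)}\right)\mathcal D_2\!\left(\frac{2c_1(n/T)}{T\Delta_1(n/T)}\right)\mathcal D_2\!\left(\frac{2c_1(n_- /T)}{T\Delta_1(n_-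 /T)}\right)\\ &+\sum_{n=1}^{sT-1}\frac{4\,\mathcal G_{T,3}(n_- /T)}{T^2\Delta_1(n/T)}+\sum_{n=1}^{sT-1}\frac{4c_1(n/T)}{\pi T(1-\cos(\Delta_1(n/T)/2))}\mathcal D_2\!\left(\frac{2c_1(n_- /T)}{T\Delta_1(n_- /T)}\right)\\ &+\sum_{n=1}^{sT-1}\frac{4\,\mathcal G_{T,4}(n_- /T)}{T\Delta_0(n/T)}\mathcal D_2\!\left(\frac{2c_1(n_- /T)}{T\Delta_1(n_- /T)}\right)+\sum_{n=0}^{sT-1}\frac{24c_1(n/T)^2}{T^2\Delta_1(n/T)^2}\\ &+\sum_{n=0}^{sT-1}\frac{4c_1(n/T)^2}{T^2\Delta_1(n/T)^2}\left(1-\frac{2c_1(n/T)}{T\Delta_1(n/T)}\right)^{-1}. \end{aligned}$$ -/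

import Mathlib

noncomputable section

namespace DiscreteAdiabatic

/-! Throughout, a fixed number `T` of steps is given and a discrete time `s = n / T` is represented
by the integer `n`; so `f (n + 1)` stands for the value of `f` at `s + 1 / T`, and the difference
operator `D f (s) = f (s + 1 / T) - f s` is `fwdDiff 1 f n`. -/

/-! ### Arcs and multistep gaps -/

/-- A (nonempty, closed) arc of the unit circle. -/
def IsArc (A : Set ℂ) : Prop :=
  ∃ a b : ℝ, a ≤ b ∧ A = (fun θ : ℝ => Complex.exp (θ * Complex.I)) '' Set.Icc a b

/-- The minimum angular distance between two sets of points of the unit circle. -/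
def angularDist (A B : Set ℂ) : ℝ :=
  sInf (Set.image2 InnerProductGeometry.angle A B)

/-- `δ` is a gap at time `n` for `k + 1` successive steps: it is the minimum angular distance between
two non-intersecting arcs of the unit circle, one containing `σP n, …, σP (n + k)`, the other one
containing `σQ n, …, σQ (n + k)`. -/
def IsMultistepGap (σP σQ : ℕ → Set ℂ) (k n : ℕ) (δ : ℝ) : Prop :=
  ∃ A B : Set ℂ, IsArc A ∧ IsArc B ∧ Disjoint A B ∧
    (⋃ l ∈ Set.Iic k, σP (n + l)) ⊆ A ∧ (⋃ l ∈ Set.Iic k, σQ (n + l)) ⊆ B ∧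
    δ = angularDist A B

/-! ### Actual and ideal evolution -/

section Operators

variable {H : Type*} [NormedAddCommGroup H] [InnerProductSpace ℂ H] [CompleteSpace H]

/-- The spectral projection of the unitary `W` onto the part `σ` of its spectrum, by functional
calculus; `σ` is meant to be open and closed in the spectrum of `W`. -/
def specProj (W : H →L[ℂ] H) (σ : Set ℂ) : H →L[ℂ] H :=
  cfc (σ.indicator (1 : ℂ → ℂ)) W

/-- `U (n + 1) = W n * U n`, `U 0 = 1`, that is `U n = W (n - 1) * ⋯ * W 1 * W 0`. -/
def evolution (W : ℕ → H →L[ℂ] H) : ℕ → H →L[ℂ] H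
  | 0 => 1
  | n + 1 => W n * evolution W n

/-- `S = P' P + Q' Q` for the projections `P`, `P'` and their complements `Q = 1 - P`,
`Q' = 1 - P'`. -/
def opS (P' P : H →L[ℂ] H) : H →L[ℂ] H :=
  P' * P + (1 - P') * (1 - P)

/-- `v = √(S S†)`. -/
def opv (P' P : H →L[ℂ] H) : H →L[ℂ] H :=
  CFC.sqrt (opS P' P * star (opS P' P))

/-- `V = v⁻¹ S`, the unitary of the left polar decomposition of `S` (when `v` is invertible). -/
def opV (P' P : H →L[ℂ] H) : H →L[ℂ] H :=
  Ring.inverse (opv P' P) * opS P' P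

/-- The adiabatic walk operator `W^A(s) = V(s + 1/T, s) W(s)`, where `P(s)` is the spectral
projection of `W(s)` onto `σP(s)`. -/
def adiabaticWalk (W : ℕ → H →L[ℂ] H) (σP : ℕ → Set ℂ) (n : ℕ) : H →L[ℂ] H :=
  opV (specProj (W (n + 1)) (σP (n + 1))) (specProj (W n) (σP n)) * W n

/-- The ideal adiabatic evolution: `U^A(0) = 1`, `U^A(s + 1/T) = W^A(s) U^A(s)`. -/
def adiabaticEvolution (W : ℕ → H →L[ℂ] H) (σP : ℕ → Set ℂ) : ℕ → H →L[ℂ] H :=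
  evolution (adiabaticWalk W σP)

end Operators

/-! ### The scalar functions of the bound -/

def D₁ (z : ℝ) : ℝ := 1 / √(1 - z ^ 2)

def D₂ (z : ℝ) : ℝ := √((1 + z) / (1 - z)) - 1

def D₃ (z : ℝ) : ℝ := z / (1 - z ^ 2) ^ (3 / 2 : ℝ)

section Scalars

variable (T : ℕ) (c Δ : ℕ → ℕ → ℝ)

/-- `c k n` and `Δ k n` stand for `c_k(n/T)` and `Δ_k(n/T)`. -/
def G₁ (n : ℕ) : ℝ :=
  (c 1 n ^ 2 + c 1 n * c 1 (n + 1)) / (Real.pi * (1 - Real.cos (Δ 2 n / 2))) + 2 * c 2 n / Δ 2 n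

def G₂ (n : ℕ) : ℝ :=
  G₁ c Δ n * D₃ (max (2 * c 1 (n + 1) / (T * Δ 1 (n + 1))) (2 * c 1 n / (T * Δ 1 n)))

def G₃ (n : ℕ) : ℝ :=
  G₂ T c Δ n * (1 + 2 * c 1 n / (T * Δ 1 n)) +
    D₁ (2 * c 1 n / (T * Δ 1 n)) * (G₁ c Δ n + 8 * c 1 n ^ 2 / Δ 1 n ^ 2)

def G₄ (n : ℕ) : ℝ := G₃ T c Δ n / T + c 1 n

end Scalars

end DiscreteAdiabatic

end

noncomputable section

namespace DiscreteAdiabatic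

/-! ### Arcs of the unit circle -/

/-! Write `A` for the ideal evolution, `U` for the actual one, and Ω = A†U. As `U - A = A (Ω - 1)`,
it suffices to bound Ω - 1. One step changes Ω by A†(V† - 1)AΩ, with `A` taken after the step. With
D = P' - P, the polar decomposition reads V† = v + Y, where v = √(1 - D²) differs from 1 only to
second order in 1/T, and Y = v⁻¹[P, P'] is of first order. Summed naively, the Y terms would give an
error of order one.

They oscillate, however: Y is off-diagonal with respect to the projection P' at the next time.
Because of the spectral gap there is an off-diagonal X with Y = W⁻¹XW - X, where W is the walk
operator at that time. Hence A†YA is, up to second-order terms, a discrete derivative of A†XA, and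
summation by parts leaves boundary terms of order 1/T and T summands of order 1/T². This is
`norm_evolution_sub_evolution_le`.

Everything quantitative comes from Sylvester equations XR - LX = Z between separated spectral parts.
Of two disjoint arcs at angular distance δ the shorter is enclosed in a disk from which the other
arc keeps its distance, so a Neumann series replaces contour integrals and gives the constant 1/(2
sin(δ/2)), called `gapConst`. Applied to the identity, to second differences of projections and to
X, it yields `GapBound.norm_sub_le`, `GapBound.norm_secondDiff_le`, `GapBound.norm_le_of_commutator`
and `GapBound.norm_sub_le_of_commutator`. The Lipschitz estimate `norm_opY_sub_opY_le` turns second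
differences of P into first differences of Y. -/

lemma IsArc.isCompact {A : Set ℂ} (hA : IsArc A) : IsCompact A := by
  obtain ⟨a, b, -, rfl⟩ := hA
  exact isCompact_Icc.image (by fun_prop)

lemma IsArc.nonempty {A : Set ℂ} (hA : IsArc A) : A.Nonempty := by
  obtain ⟨a, b, hab, rfl⟩ := hA
  exact (Set.nonempty_Icc.mpr hab).image _

lemma IsArc.norm_eq_one {A : Set ℂ} (hA : IsArc A) {z : ℂ} (hz : z ∈ A) : ‖z‖ = 1 := by
  obtain ⟨a, b, -, rfl⟩ := hA
  obtain ⟨θ, -, rfl⟩ := hz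
  exact Complex.norm_exp_ofReal_mul_I θ

lemma angularDist_mem {A B : Set ℂ} (hA : IsArc A) (hB : IsArc B) :
    angularDist A B ∈ Set.image2 InnerProductGeometry.angle A B := by
  refine IsCompact.sInf_mem ?_ (hA.nonempty.image2 hB.nonempty)
  rw [← Set.image_prod]
  refine (hA.isCompact.prod hB.isCompact).image_of_continuousOn fun x hx => ?_
  refine (InnerProductGeometry.continuousAt_angle ?_ ?_).continuousWithinAt
  · exact norm_ne_zero_iff.mp (by simp [hA.norm_eq_one hx.1])
  · exact norm_ne_zero_iff.mp (by simp [hB.norm_eq_one hx.2])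

lemma angularDist_le {A B : Set ℂ} {x y : ℂ} (hx : x ∈ A) (hy : y ∈ B) :
    angularDist A B ≤ InnerProductGeometry.angle x y :=
  csInf_le ⟨0, by rintro _ ⟨x, -, y, -, rfl⟩; exact InnerProductGeometry.angle_nonneg _ _⟩
    ⟨x, hx, y, hy, rfl⟩

lemma angularDist_pos {A B : Set ℂ} (hA : IsArc A) (hB : IsArc B) (hAB : Disjoint A B) :
    0 < angularDist A B := by
  obtain ⟨x, hx, y, hy, h⟩ := angularDist_mem hA hB
  rw [← h]
  refine lt_of_le_of_ne (InnerProductGeometry.angle_nonneg _ _) fun h0 => ?_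
  obtain ⟨-, r, hr, rfl⟩ := InnerProductGeometry.angle_eq_zero_iff.mp h0.symm
  have h1 := hB.norm_eq_one hy
  rw [norm_smul, hA.norm_eq_one hx, mul_one, Real.norm_of_nonneg hr.le] at h1
  subst h1
  rw [one_smul] at hy
  exact Set.disjoint_left.mp hAB hx hy

lemma angularDist_le_pi {A B : Set ℂ} (hA : IsArc A) (hB : IsArc B) :
    angularDist A B ≤ Real.pi := by
  obtain ⟨x, hx, y, hy, h⟩ := angularDist_mem hA hB
  exact h ▸ InnerProductGeometry.angle_le_pi _ _

lemma angularDist_comm (A B : Set ℂ) : angularDist A B = angularDist B A := by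
  unfold angularDist
  rw [Set.image2_swap]
  simp only [InnerProductGeometry.angle_comm]

lemma angle_exp_le (x y : ℝ) :
    InnerProductGeometry.angle (Complex.exp (x * Complex.I)) (Complex.exp (y * Complex.I))
      ≤ |x - y| := by
  rcases le_or_gt |x - y| Real.pi with h | h
  · rw [Complex.angle_exp_exp]
    -- The representative of `x - y` is taken in (-π, π], so the value -π becomes π and needs its
    -- own case.
    rcases eq_or_lt_of_le (neg_le_of_abs_le h) with h1 | h1
    · have := toIocMod_mem_Ioc Real.two_pi_pos (-Real.pi) (x - y)
      have h2 : |x - y| = Real.pi := by rw [← h1, abs_neg, abs_of_pos Real.pi_pos]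
      rw [h2, abs_le]
      constructor <;> linarith [this.1, this.2]
    · rw [(toIocMod_eq_self Real.two_pi_pos).mpr ⟨h1, by linarith [le_of_abs_le h]⟩]
  · exact (InnerProductGeometry.angle_le_pi _ _).trans h.le

/-- `σ` lies in a closed disk and `τ` outside of the concentric disk whose radius is larger
by `δ`. -/
def DiskSeparated (σ τ : Set ℂ) (δ : ℝ) : Prop :=
  ∃ (w : ℂ) (r : ℝ), 0 ≤ r ∧ (∀ z ∈ σ, ‖z - w‖ ≤ r) ∧ ∀ z ∈ τ, r + δ ≤ ‖z - w‖

lemma DiskSeparated.mono {σ τ σ' τ' : Set ℂ} {δ : ℝ} (h : DiskSeparated σ τ δ) (hσ : σ' ⊆ σ)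
    (hτ : τ' ⊆ τ) : DiskSeparated σ' τ' δ := by
  obtain ⟨w, r, hr, h1, h2⟩ := h
  exact ⟨w, r, hr, fun z hz => h1 z (hσ hz), fun z hz => h2 z (hτ hz)⟩

lemma norm_sq_exp_sub (m t κ : ℝ) :
    ‖Complex.exp ((m + t : ℝ) * Complex.I) - κ * Complex.exp (m * Complex.I)‖ ^ 2
      = 1 + κ ^ 2 - 2 * κ * Real.cos t := by
  have h : Complex.exp ((m + t : ℝ) * Complex.I) - κ * Complex.exp (m * Complex.I)
      = Complex.exp (m * Complex.I) * (Complex.exp (t * Complex.I) - κ) := by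
    rw [mul_sub, ← Complex.exp_add]
    push_cast
    ring_nf
  rw [h, norm_mul, Complex.norm_exp_ofReal_mul_I, one_mul, ← Complex.normSq_eq_norm_sq,
    Complex.normSq_apply]
  simp only [Complex.sub_re, Complex.sub_im, Complex.exp_ofReal_mul_I_re,
    Complex.exp_ofReal_mul_I_im, Complex.ofReal_re, Complex.ofReal_im, sub_zero]
  nlinarith [Real.sin_sq_add_cos_sq t]

/-- Two arcs `[a, b]` and `[a', b']` (in angles), the first one not longer than the second one, at
angular distance more than `2 x`. -/
lemma diskSeparated_of_angles {a b a' b' x : ℝ} (hab : a ≤ b) (hab' : a' ≤ b')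
    (hlen : b - a ≤ b' - a') (hx : 0 < x) (h1 : b + 2 * x < a')
    (h2 : b' < a + 2 * Real.pi - 2 * x) :
    DiskSeparated ((fun θ : ℝ => Complex.exp (θ * Complex.I)) '' Set.Icc a b)
      ((fun θ : ℝ => Complex.exp (θ * Complex.I)) '' Set.Icc a' b') (2 * Real.sin x) := by
  set β : ℝ := (b - a) / 2 + x with hβ
  have hβ0 : 0 < β := by linarith
  -- The two arcs and the two gaps fit into one turn, and the first arc is the shorter: hence 2(b -
  -- a) + 4x < 2π.
  have hβ1 : β < Real.pi / 2 := by linarith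
  have hxβ : x ≤ β := by linarith
  have hcos : 0 < Real.cos β := Real.cos_pos_of_mem_Ioo ⟨by linarith, hβ1⟩
  have hcosx : 0 < Real.cos x := Real.cos_pos_of_mem_Ioo ⟨by linarith, by linarith⟩
  -- Measure angles from the midpoint of the first arc. The line through the circle points at angles
  -- β - x (the end of that arc) and β + x meets the axis of symmetry at distance cos x / cos β from
  -- the origin. With this point as centre of the disk, the distances to the two circle points
  -- differ by the whole chord 2 sin x.
  set κ : ℝ := Real.cos x / Real.cos β with hκ
  have hκ0 : 0 < κ := div_pos hcosx hcos
  have hκβ : κ * Real.cos β = Real.cos x := div_mul_cancel₀ _ hcos.ne'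
  have hsin : 0 < Real.sin x := Real.sin_pos_of_pos_of_lt_pi hx (by linarith)
  have hr : 0 ≤ κ * Real.sin β - Real.sin x := by
    have : 0 ≤ Real.sin (β - x) :=
      Real.sin_nonneg_of_nonneg_of_le_pi (by linarith) (by linarith)
    rw [Real.sin_sub] at this
    rw [hκ, div_mul_eq_mul_div, sub_nonneg, le_div_iff₀ hcos]
    nlinarith
  have key1 : 1 + κ ^ 2 - 2 * κ * Real.cos ((b - a) / 2) = (κ * Real.sin β - Real.sin x) ^ 2 := by
    have : (b - a) / 2 = β - x := by rw [hβ]; ring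
    rw [this, Real.cos_sub]
    have e1 := Real.sin_sq_add_cos_sq β
    have e2 := Real.sin_sq_add_cos_sq x
    have e3 : κ ^ 2 * Real.cos β ^ 2 = Real.cos x ^ 2 := by rw [← mul_pow, hκβ]
    linear_combination (-κ ^ 2) * e1 - e2 + e3 - 2 * Real.cos x * hκβ
  have key2 : 1 + κ ^ 2 - 2 * κ * Real.cos ((b - a) / 2 + 2 * x)
      = (κ * Real.sin β - Real.sin x + 2 * Real.sin x) ^ 2 := by
    have : (b - a) / 2 + 2 * x = β + x := by rw [hβ]; ring
    rw [this, Real.cos_add]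
    have e1 := Real.sin_sq_add_cos_sq β
    have e2 := Real.sin_sq_add_cos_sq x
    have e3 : κ ^ 2 * Real.cos β ^ 2 = Real.cos x ^ 2 := by rw [← mul_pow, hκβ]
    linear_combination (-κ ^ 2) * e1 - e2 + e3 - 2 * Real.cos x * hκβ
  refine ⟨κ * Complex.exp (((a + b) / 2 : ℝ) * Complex.I), κ * Real.sin β - Real.sin x, hr, ?_, ?_⟩
  · rintro _ ⟨θ, ⟨hθ1, hθ2⟩, rfl⟩
    have hc : Real.cos ((b - a) / 2) ≤ Real.cos (θ - (a + b) / 2) := by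
      rw [← Real.cos_abs (θ - (a + b) / 2)]
      exact Real.cos_le_cos_of_nonneg_of_le_pi (abs_nonneg _) (by linarith)
        (abs_le.mpr ⟨by linarith, by linarith⟩)
    have := norm_sq_exp_sub ((a + b) / 2) (θ - (a + b) / 2) κ
    rw [add_sub_cancel] at this
    refine abs_le_of_sq_le_sq' ?_ hr |>.2
    rw [this, ← key1]
    nlinarith
  · rintro _ ⟨θ, ⟨hθ1, hθ2⟩, rfl⟩
    have hc : Real.cos (θ - (a + b) / 2) ≤ Real.cos ((b - a) / 2 + 2 * x) := by
      -- Angles beyond π are reflected to 2π minus the angle, where the cosine is again decreasing.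
      rcases le_total (θ - (a + b) / 2) Real.pi with h | h
      · exact Real.cos_le_cos_of_nonneg_of_le_pi (by linarith) h (by linarith)
      · rw [← Real.cos_two_pi_sub (θ - (a + b) / 2)]
        exact Real.cos_le_cos_of_nonneg_of_le_pi (by linarith) (by linarith) (by linarith)
    have := norm_sq_exp_sub ((a + b) / 2) (θ - (a + b) / 2) κ
    rw [add_sub_cancel] at this
    refine abs_le_of_sq_le_sq' ?_ (norm_nonneg _) |>.2
    rw [this, ← key2]
    nlinarith

lemma diskSeparated_or_of_isArc {A B : Set ℂ} (hA : IsArc A) (hB : IsArc B) (hAB : Disjoint A B)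
    {x : ℝ} (hx : 0 < x) (hxd : 2 * x < angularDist A B) :
    DiskSeparated A B (2 * Real.sin x) ∨ DiskSeparated B A (2 * Real.sin x) := by
  obtain ⟨a, b, hab, rfl⟩ := hA
  obtain ⟨a', b', hab', rfl⟩ := hB
  -- Turning the second arc by full circles makes it start in [a, a + 2π); disjointness then forces
  -- it to lie strictly between `b` and `a + 2π`.
  obtain ⟨k, ⟨hk1, hk2⟩, -⟩ := existsUnique_add_zsmul_mem_Ico Real.two_pi_pos a' a
  have hper : ∀ θ : ℝ, Complex.exp ((θ + k • (2 * Real.pi) : ℝ) * Complex.I)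
      = Complex.exp (θ * Complex.I) := fun θ => by
    have := Complex.exp_int_mul_two_pi_mul_I k
    push_cast [zsmul_eq_mul]
    rw [add_mul, Complex.exp_add, mul_assoc (k : ℂ), this, mul_one]
  have himg : (fun θ : ℝ => Complex.exp (θ * Complex.I)) '' Set.Icc a' b'
      = (fun θ : ℝ => Complex.exp (θ * Complex.I)) ''
        Set.Icc (a' + k • (2 * Real.pi)) (b' + k • (2 * Real.pi)) := by
    rw [← Set.image_add_const_Icc, Set.image_image]
    exact Set.image_congr fun θ _ => (hper θ).symm
  rw [himg] at hAB hxd ⊢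
  clear himg hper
  have hq : a' + k • (2 * Real.pi) ≤ b' + k • (2 * Real.pi) := by linarith
  generalize a' + k • (2 * Real.pi) = p at *
  generalize b' + k • (2 * Real.pi) = q at *
  have hdis : ∀ θ ∈ Set.Icc a b, ∀ φ ∈ Set.Icc p q,
      Complex.exp (θ * Complex.I) ≠ Complex.exp (φ * Complex.I) := fun θ hθ φ hφ h =>
    Set.disjoint_left.mp hAB (Set.mem_image_of_mem _ hθ) ⟨φ, hφ, h.symm⟩
  have hbp : b < p := by
    by_contra! h
    exact hdis p ⟨hk1, h⟩ p ⟨le_rfl, hq⟩ rfl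
  have hqa : q < a + 2 * Real.pi := by
    by_contra! h
    refine hdis a ⟨le_rfl, hab⟩ (a + 2 * Real.pi) ⟨hk2.le, h⟩ ?_
    push_cast
    rw [add_mul, Complex.exp_add, Complex.exp_two_pi_mul_I, mul_one]
  have mem : ∀ {θ s t : ℝ}, θ ∈ Set.Icc s t → Complex.exp (θ * Complex.I)
      ∈ (fun θ : ℝ => Complex.exp (θ * Complex.I)) '' Set.Icc s t := fun h => ⟨_, h, rfl⟩
  have g1 : 2 * x < p - b := by
    refine hxd.trans_le ((angularDist_le (x := Complex.exp (b * Complex.I))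
      (y := Complex.exp (p * Complex.I)) (mem ⟨hab, le_rfl⟩) (mem ⟨le_rfl, hq⟩)).trans
      ((angle_exp_le _ _).trans ?_))
    rw [abs_sub_comm, abs_of_pos (by linarith)]
  have g2 : 2 * x < a + 2 * Real.pi - q := by
    have e : Complex.exp ((a + 2 * Real.pi : ℝ) * Complex.I) = Complex.exp (a * Complex.I) := by
      push_cast
      rw [add_mul, Complex.exp_add, Complex.exp_two_pi_mul_I, mul_one]
    refine hxd.trans_le ((angularDist_le (x := Complex.exp ((a + 2 * Real.pi : ℝ) * Complex.I))
      (y := Complex.exp (q * Complex.I)) (e ▸ mem ⟨le_rfl, hab⟩) (mem ⟨hq, le_rfl⟩)).trans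
      ((angle_exp_le _ _).trans ?_))
    rw [abs_of_pos (by linarith)]
  rcases le_total (b - a) (q - p) with h | h
  · exact .inl (diskSeparated_of_angles hab hq h hx (by linarith) (by linarith))
  · right
    -- If the second arc is the shorter one, it takes the role of the first, followed by the first
    -- arc turned once around.
    have e : (fun θ : ℝ => Complex.exp (θ * Complex.I)) '' Set.Icc a b
        = (fun θ : ℝ => Complex.exp (θ * Complex.I)) ''
          Set.Icc (a + 2 * Real.pi) (b + 2 * Real.pi) := by
      rw [← Set.image_add_const_Icc, Set.image_image]
      refine Set.image_congr fun θ _ => ?_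
      push_cast
      rw [add_mul, Complex.exp_add, Complex.exp_two_pi_mul_I, mul_one]
    rw [e]
    exact diskSeparated_of_angles hq (by linarith) (by linarith) hx (by linarith) (by linarith)

/-! ### Sylvester equations with separated coefficients -/

section Sylvester

variable {𝓐 : Type*} [NormedRing 𝓐] [NormedAlgebra ℂ 𝓐]

/-- The solutions `X = E X G` of `X R - L X = Z` are bounded by `κ ‖Z‖`. -/
def SylvesterBound (L E R G : 𝓐) (κ : ℝ) : Prop :=
  ∀ X : 𝓐, E * X = X → X * G = X → ‖X‖ ≤ κ * ‖X * R - L * X‖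

/-- `X R - L X = Z` has a solution `X = E X G` whenever `Z = E Z G`. -/
def SylvesterSolvable (L E R G : 𝓐) : Prop :=
  ∀ Z : 𝓐, E * Z = Z → Z * G = Z → ∃ X, E * X = X ∧ X * G = X ∧ X * R - L * X = Z

lemma exists_eq_mul_mul_add [CompleteSpace 𝓐] {a b : 𝓐} (hab : ‖a‖ * ‖b‖ < 1) (c : 𝓐) :
    ∃ X, X = a * X * b + c := by
  have h : ‖ContinuousLinearMap.mulLeftRight ℂ 𝓐 a b‖ < 1 :=
    (ContinuousLinearMap.opNorm_mulLeftRight_apply_apply_le ℂ 𝓐 a b).trans_lt hab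
  obtain ⟨u, hu⟩ := isUnit_one_sub_of_norm_lt_one h
  refine ⟨(↑u⁻¹ : 𝓐 →L[ℂ] 𝓐) c, ?_⟩
  have := congrArg (fun f : 𝓐 →L[ℂ] 𝓐 => f c) u.mul_inv
  simp only [hu, mul_apply_eq_comp, sub_apply,
    one_apply_eq_self, ContinuousLinearMap.mulLeftRight_apply] at this
  rw [sub_eq_iff_eq_add] at this
  rw [add_comm]
  exact this

variable {L E R G M : 𝓐} {w : ℂ} {r ρ : ℝ}

/-- Subtracting `w` from both coefficients does not change XR - LX. Solving for X with the partial
inverse `M` of R - w leaves (L - w)EX on the right, of norm at most r‖X‖, which is absorbed because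
r < ρ. -/
lemma sylvesterBound_of_left_le (hr : 0 ≤ r) (hrρ : r < ρ)
    (hL : ‖(L - algebraMap ℂ 𝓐 w) * E‖ ≤ r) (hRM : (R - algebraMap ℂ 𝓐 w) * M = G)
    (hM : ‖M‖ ≤ ρ⁻¹) : SylvesterBound L E R G (ρ - r)⁻¹ := by
  intro X hEX hXG
  have hρ : 0 < ρ := hr.trans_lt hrρ
  have h1 : X = ((X * R - L * X) + (L - algebraMap ℂ 𝓐 w) * E * X) * M := by
    rw [mul_assoc _ E, hEX]
    have := Algebra.commutes w X
    calc X = X * ((R - algebraMap ℂ 𝓐 w) * M) := by rw [hRM, hXG]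
      _ = (X * R - algebraMap ℂ 𝓐 w * X) * M := by rw [this]; noncomm_ring
      _ = _ := by noncomm_ring
  have h2 : ‖X‖ ≤ (‖X * R - L * X‖ + r * ‖X‖) * ρ⁻¹ := by
    conv_lhs => rw [h1]
    refine (norm_mul_le _ _).trans ?_
    gcongr
    refine (norm_add_le _ _).trans ?_
    gcongr
    refine (norm_mul_le _ _).trans ?_
    gcongr
  rw [← div_eq_mul_inv, le_div_iff₀ hρ] at h2
  rw [inv_mul_eq_div, le_div_iff₀ (sub_pos.mpr hrρ)]
  linarith

lemma sylvesterBound_of_right_le (hr : 0 ≤ r) (hrρ : r < ρ)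
    (hR : ‖(R - algebraMap ℂ 𝓐 w) * G‖ ≤ r) (hRG : R * G = G * R)
    (hLM : M * (L - algebraMap ℂ 𝓐 w) = E)
    (hM : ‖M‖ ≤ ρ⁻¹) : SylvesterBound L E R G (ρ - r)⁻¹ := by
  intro X hEX hXG
  have hρ : 0 < ρ := hr.trans_lt hrρ
  have h1 : X = M * (X * ((R - algebraMap ℂ 𝓐 w) * G) - (X * R - L * X)) := by
    have e := Algebra.commutes w G
    have e' := Algebra.commutes w X
    have e2 : X * ((R - algebraMap ℂ 𝓐 w) * G) = X * R - X * algebraMap ℂ 𝓐 w := by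
      rw [sub_mul, hRG, e, ← mul_sub, ← mul_assoc, hXG, mul_sub]
    rw [e2, ← e']
    calc X = (M * (L - algebraMap ℂ 𝓐 w)) * X := by rw [hLM, hEX]
      _ = _ := by noncomm_ring
  have h2 : ‖X‖ ≤ ρ⁻¹ * (‖X‖ * r + ‖X * R - L * X‖) := by
    conv_lhs => rw [h1]
    refine (norm_mul_le _ _).trans ?_
    gcongr
    refine (norm_sub_le _ _).trans ?_
    gcongr
    refine (norm_mul_le _ _).trans ?_
    gcongr
  rw [inv_mul_eq_div, le_div_iff₀ hρ] at h2
  rw [inv_mul_eq_div, le_div_iff₀ (sub_pos.mpr hrρ)]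
  linarith

lemma mul_norm_lt_one {a b : ℝ} (ha : a ≤ r) (hb0 : 0 ≤ b) (hb : b ≤ ρ⁻¹) (hr : 0 ≤ r)
    (hrρ : r < ρ) : a * b < 1 := by
  have hρ : 0 < ρ := hr.trans_lt hrρ
  calc a * b ≤ r * ρ⁻¹ := by gcongr
    _ < 1 := by rwa [← div_eq_mul_inv, div_lt_one hρ]

/-- The equation is the fixed-point problem X = (L - w)E X M + ZM, a contraction with factor r/ρ.
The block conditions on X follow from the fixed-point equation itself. -/
lemma sylvesterSolvable_of_left_le [CompleteSpace 𝓐] (hr : 0 ≤ r) (hrρ : r < ρ)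
    (hL : ‖(L - algebraMap ℂ 𝓐 w) * E‖ ≤ r) (hLE : L * E = E * L) (hE : E * E = E)
    (hMR : M * (R - algebraMap ℂ 𝓐 w) = G) (hMG : M * G = M)
    (hM : ‖M‖ ≤ ρ⁻¹) : SylvesterSolvable L E R G := by
  intro Z hEZ hZG
  obtain ⟨X, hX⟩ := exists_eq_mul_mul_add (mul_norm_lt_one hL (norm_nonneg M) hM hr hrρ) (Z * M)
  have hc : (L - algebraMap ℂ 𝓐 w) * E = E * (L - algebraMap ℂ 𝓐 w) := by
    rw [sub_mul, hLE, Algebra.commutes, mul_sub]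
  have hEX : E * X = X := by
    conv_lhs => rw [hX]
    conv_rhs => rw [hX]
    rw [mul_add, hc, ← mul_assoc E Z, hEZ]
    congr 1
    simp only [← mul_assoc, hE]
  have hXG : X * G = X := by
    conv_lhs => rw [hX]
    conv_rhs => rw [hX]
    rw [add_mul, mul_assoc _ M, mul_assoc _ M, hMG]
  refine ⟨X, hEX, hXG, ?_⟩
  have h : X * (R - algebraMap ℂ 𝓐 w) = (L - algebraMap ℂ 𝓐 w) * X + Z := by
    conv_lhs => rw [hX]
    rw [add_mul, mul_assoc _ M, mul_assoc _ M, hMR, hZG, mul_assoc _ X, hXG, mul_assoc _ E, hEX]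
  have e := Algebra.commutes w X
  rw [mul_sub, ← e, sub_mul] at h
  rw [sub_eq_iff_eq_add] at h ⊢
  rw [h]
  abel

lemma sylvesterSolvable_of_right_le [CompleteSpace 𝓐] (hr : 0 ≤ r) (hrρ : r < ρ)
    (hR : ‖(R - algebraMap ℂ 𝓐 w) * G‖ ≤ r) (hRG : R * G = G * R) (hG : G * G = G)
    (hLM : (L - algebraMap ℂ 𝓐 w) * M = E) (hEM : E * M = M)
    (hM : ‖M‖ ≤ ρ⁻¹) : SylvesterSolvable L E R G := by
  intro Z hEZ hZG
  obtain ⟨X, hX⟩ := exists_eq_mul_mul_add (a := M) (b := (R - algebraMap ℂ 𝓐 w) * G)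
    (by rw [mul_comm]; exact mul_norm_lt_one hR (norm_nonneg M) hM hr hrρ) (-(M * Z))
  have hc : (R - algebraMap ℂ 𝓐 w) * G = G * (R - algebraMap ℂ 𝓐 w) := by
    rw [sub_mul, hRG, Algebra.commutes, mul_sub]
  have hEX : E * X = X := by
    conv_lhs => rw [hX]
    conv_rhs => rw [hX]
    simp only [mul_add, mul_neg, ← mul_assoc, hEM]
  have hXG : X * G = X := by
    conv_lhs => rw [hX]
    conv_rhs => rw [hX]
    simp only [add_mul, neg_mul, mul_assoc, hG, hZG]
  refine ⟨X, hEX, hXG, ?_⟩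
  have h : (L - algebraMap ℂ 𝓐 w) * X = X * (R - algebraMap ℂ 𝓐 w) - Z := by
    conv_lhs => rw [hX]
    rw [mul_add, hc, mul_neg, ← mul_assoc _ M Z, hLM, hEZ, ← mul_assoc, ← mul_assoc, ← mul_assoc,
      hLM, hEX, hXG, ← sub_eq_add_neg]
  have e := Algebra.commutes w X
  rw [mul_sub, ← e, sub_mul] at h
  rw [sub_eq_iff_eq_add] at h
  rw [h]
  abel

end Sylvester

/-! ### Spectral projections -/

section Spectral

variable {H : Type*} [NormedAddCommGroup H] [InnerProductSpace ℂ H] [CompleteSpace H]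

/-- The spectrum of the normal operator `W` is the union of the disjoint closed sets `σ`, `τ`. -/
structure SpectralSplit (W : H →L[ℂ] H) (σ τ : Set ℂ) : Prop where
  normal : IsStarNormal W
  spectrum_eq : spectrum ℂ W = σ ∪ τ
  closed_left : IsClosed σ
  closed_right : IsClosed τ
  disjoint : Disjoint σ τ

namespace SpectralSplit

variable {W : H →L[ℂ] H} {σ τ : Set ℂ}

lemma symm (h : SpectralSplit W σ τ) : SpectralSplit W τ σ :=
  ⟨h.normal, by rw [h.spectrum_eq, Set.union_comm], h.closed_right, h.closed_left,
    h.disjoint.symm⟩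

/-- Both parts are closed and disjoint, so a function may be chosen independently on each; this
makes the continuous functional calculus enough for spectral projections. -/
lemma continuousOn_indicator (h : SpectralSplit W σ τ) {f : ℂ → ℂ} (hf : ContinuousOn f σ) :
    ContinuousOn (σ.indicator f) (spectrum ℂ W) := by
  rw [h.spectrum_eq]
  refine ContinuousOn.union_of_isClosed ?_ ?_ h.closed_left h.closed_right
  · exact hf.congr fun z hz => Set.indicator_of_mem hz f
  · exact (continuousOn_const (c := (0 : ℂ))).congr fun z hz =>
      Set.indicator_of_notMem (Set.disjoint_right.mp h.disjoint hz) f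

lemma continuousOn_indicator_one (h : SpectralSplit W σ τ) :
    ContinuousOn (σ.indicator (1 : ℂ → ℂ)) (spectrum ℂ W) :=
  h.continuousOn_indicator continuousOn_const

lemma isStarProjection (h : SpectralSplit W σ τ) : IsStarProjection (specProj W σ) := by
  have := h.normal
  constructor
  · have h1 := h.continuousOn_indicator_one
    rw [IsIdempotentElem, specProj, ← cfc_mul _ _ _ h1 h1]
    refine cfc_congr fun z _ => ?_
    by_cases hz : z ∈ σ <;> simp [hz]
  · rw [IsSelfAdjoint, specProj, ← cfc_star]
    refine cfc_congr fun z _ => ?_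
    by_cases hz : z ∈ σ <;> simp [hz]

lemma one_sub (h : SpectralSplit W σ τ) : 1 - specProj W σ = specProj W τ := by
  have := h.normal
  rw [specProj, ← cfc_const_one ℂ W, ← cfc_sub _ _ _ continuousOn_const
    h.continuousOn_indicator_one, specProj]
  refine cfc_congr fun z hz => ?_
  rw [h.spectrum_eq] at hz
  rcases hz with hz | hz
  · simp [hz, Set.disjoint_left.mp h.disjoint hz]
  · simp [hz, Set.disjoint_right.mp h.disjoint hz]

lemma commute (h : SpectralSplit W σ τ) : W * specProj W σ = specProj W σ * W := by
  have := h.normal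
  exact (Commute.cfc (Commute.refl W) (star_comm_self' W) _).symm

lemma sub_algebraMap_eq (h : SpectralSplit W σ τ) (w : ℂ) :
    W - algebraMap ℂ _ w = cfc (fun z => z - w) W := by
  have := h.normal
  rw [cfc_sub _ _ _ (by fun_prop) (by fun_prop), cfc_id' ℂ W, cfc_const w W]

lemma norm_sub_mul_le (h : SpectralSplit W σ τ) {w : ℂ} {r : ℝ} (hr : 0 ≤ r)
    (hσ : ∀ z ∈ σ, ‖z - w‖ ≤ r) : ‖(W - algebraMap ℂ _ w) * specProj W σ‖ ≤ r := by
  have := h.normal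
  rw [h.sub_algebraMap_eq, specProj, ← cfc_mul _ _ _ (by fun_prop) h.continuousOn_indicator_one]
  refine norm_cfc_le hr fun z _ => ?_
  by_cases hz : z ∈ σ
  · simpa [hz] using hσ z hz
  · simpa [hz] using hr

lemma exists_inverse (h : SpectralSplit W σ τ) {w : ℂ} {ρ : ℝ} (hρ : 0 < ρ)
    (hσ : ∀ z ∈ σ, ρ ≤ ‖z - w‖) : ∃ M : H →L[ℂ] H,
      (W - algebraMap ℂ _ w) * M = specProj W σ ∧ M * (W - algebraMap ℂ _ w) = specProj W σ ∧
      M * specProj W σ = M ∧ specProj W σ * M = M ∧ ‖M‖ ≤ ρ⁻¹ := by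
  have := h.normal
  have hne : ∀ z ∈ σ, z - w ≠ 0 := fun z hz h0 => by
    have := hσ z hz
    rw [h0, norm_zero] at this
    linarith
  have hc : ContinuousOn (σ.indicator fun z => (z - w)⁻¹) (spectrum ℂ W) :=
    h.continuousOn_indicator (ContinuousOn.inv₀ (by fun_prop) hne)
  have h1 := h.continuousOn_indicator_one
  refine ⟨cfc (σ.indicator fun z => (z - w)⁻¹) W, ?_, ?_, ?_, ?_, ?_⟩
  · rw [h.sub_algebraMap_eq, specProj, ← cfc_mul _ _ _ (by fun_prop) hc]
    refine cfc_congr fun z _ => ?_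
    by_cases hz : z ∈ σ <;> simp [hz, hne]
  · rw [h.sub_algebraMap_eq, specProj, ← cfc_mul _ _ _ hc (by fun_prop)]
    refine cfc_congr fun z _ => ?_
    by_cases hz : z ∈ σ <;> simp [hz, hne]
  · rw [specProj, ← cfc_mul _ _ _ hc h1]
    refine cfc_congr fun z _ => ?_
    by_cases hz : z ∈ σ <;> simp [hz]
  · rw [specProj, ← cfc_mul _ _ _ h1 hc]
    refine cfc_congr fun z _ => ?_
    by_cases hz : z ∈ σ <;> simp [hz]
  · refine norm_cfc_le (by positivity) fun z _ => ?_
    by_cases hz : z ∈ σ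
    · simp only [hz, Set.indicator_of_mem, norm_inv]
      exact inv_anti₀ hρ (hσ z hz)
    · simpa [hz] using hρ.le

variable {L R : H →L[ℂ] H} {σ' τ' : Set ℂ} {δ : ℝ}

lemma sylvester_of_diskSeparated (hL : SpectralSplit L σ τ') (hR : SpectralSplit R τ σ')
    (hδ : 0 < δ) (h : DiskSeparated σ τ δ ∨ DiskSeparated τ σ δ) :
    SylvesterBound L (specProj L σ) R (specProj R τ) δ⁻¹ ∧
      SylvesterSolvable L (specProj L σ) R (specProj R τ) := by
  rcases h with ⟨w, r, hr, h1, h2⟩ | ⟨w, r, hr, h1, h2⟩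
  · obtain ⟨M, m1, m2, m3, m4, m5⟩ := hR.exists_inverse (by linarith) h2
    have e : δ = (r + δ) - r := by ring
    have hlt : r < r + δ := by linarith
    constructor
    · rw [e]
      exact sylvesterBound_of_left_le hr hlt (hL.norm_sub_mul_le hr h1) m1 m5
    · exact sylvesterSolvable_of_left_le hr hlt (hL.norm_sub_mul_le hr h1) hL.commute
        hL.isStarProjection.isIdempotentElem m2 m3 m5
  · obtain ⟨M, m1, m2, m3, m4, m5⟩ := hL.exists_inverse (by linarith) h2
    have e : δ = (r + δ) - r := by ring
    have hlt : r < r + δ := by linarith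
    constructor
    · rw [e]
      exact sylvesterBound_of_right_le hr hlt (hR.norm_sub_mul_le hr h1) hR.commute m2 m5
    · exact sylvesterSolvable_of_right_le hr hlt (hR.norm_sub_mul_le hr h1) hR.commute
        hR.isStarProjection.isIdempotentElem m1 m4 m5

lemma sylvester_of_arcs {A B : Set ℂ} (hL : SpectralSplit L σ τ') (hR : SpectralSplit R τ σ')
    (hA : IsArc A) (hB : IsArc B) (hAB : Disjoint A B) (hσ : σ ⊆ A) (hτ : τ ⊆ B) :
    SylvesterBound L (specProj L σ) R (specProj R τ) (2 * Real.sin (angularDist A B / 2))⁻¹ ∧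
      SylvesterSolvable L (specProj L σ) R (specProj R τ) := by
  set d := angularDist A B with hd
  have hd0 : 0 < d := angularDist_pos hA hB hAB
  have hdpi : d ≤ Real.pi := angularDist_le_pi hA hB
  have key : ∀ x ∈ Set.Ioo 0 (d / 2),
      SylvesterBound L (specProj L σ) R (specProj R τ) (2 * Real.sin x)⁻¹ ∧
        SylvesterSolvable L (specProj L σ) R (specProj R τ) := fun x hx => by
    refine sylvester_of_diskSeparated hL hR ?_ ?_
    · have := Real.sin_pos_of_pos_of_lt_pi hx.1 (by linarith [hx.2, Real.pi_pos])
      linarith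
    · exact (diskSeparated_or_of_isArc hA hB hAB hx.1 (by linarith [hx.2])).imp
        (fun h => h.mono hσ hτ) fun h => h.mono hτ hσ
  refine ⟨fun X hEX hXG => ?_, (key (d / 4) ⟨by linarith, by linarith⟩).2⟩
  have hs : 0 < Real.sin (d / 2) :=
    Real.sin_pos_of_pos_of_lt_pi (by linarith) (by linarith [Real.pi_pos])
  rw [inv_mul_eq_div, le_div_iff₀ (by linarith), mul_comm]
  -- At x = d/2 the two arcs may be opposite half circles, whose separating disk degenerates to a
  -- half-plane. The bound is therefore proved for x < d/2 and passed to the limit; solvability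
  -- needs only one such x.
  have hc : ContinuousWithinAt (fun t : ℝ => 2 * Real.sin t * ‖X‖) (Set.Iio (d / 2)) (d / 2) := by
    fun_prop
  refine le_of_tendsto hc ?_
  filter_upwards [Ioo_mem_nhdsLT (half_pos hd0)] with t ht
  have := (key t ht).1 X hEX hXG
  have h0 := Real.sin_pos_of_pos_of_lt_pi ht.1 (by linarith [ht.2, Real.pi_pos])
  rwa [inv_mul_eq_div, le_div_iff₀ (by linarith), mul_comm] at this

end SpectralSplit

end Spectral

variable {H : Type*} [NormedAddCommGroup H] [InnerProductSpace ℂ H] [CompleteSpace H]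

/-! ### Block decompositions with respect to projections -/

section Blocks

variable {N P P' : H →L[ℂ] H}

lemma IsStarProjection.inner_apply_one_sub (hP : IsStarProjection P) (u v : H) :
    inner ℂ (P u) ((1 - P) v) = 0 := by
  have h : P * (1 - P) = 0 := hP.mul_one_sub_self
  have h2 : inner ℂ (P u) ((1 - P) v) = inner ℂ u (P ((1 - P) v)) := by
    rw [← ContinuousLinearMap.adjoint_inner_right, ← ContinuousLinearMap.star_eq_adjoint,
      hP.isSelfAdjoint.star_eq]
  rw [h2, ← mul_apply_eq_comp, h]
  simp

lemma norm_sq_eq_add_of_isStarProjection (hP : IsStarProjection P) (u : H) :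
    ‖u‖ ^ 2 = ‖P u‖ ^ 2 + ‖(1 - P) u‖ ^ 2 := by
  have h := norm_add_sq (𝕜 := ℂ) (P u) ((1 - P) u)
  rw [IsStarProjection.inner_apply_one_sub hP] at h
  have e : P u + (1 - P) u = u := by simp
  rw [e] at h
  simpa using h

/-- Pythagoras in the source and in the target: the two blocks act between orthogonal pieces, so
their norms combine as a maximum. This keeps the constants sharp enough below. -/
lemma norm_diag_le_max (hN : IsStarProjection N) (hP : IsStarProjection P) (X : H →L[ℂ] H) :
    ‖N * X * P + (1 - N) * X * (1 - P)‖ ≤ max ‖N * X * P‖ ‖(1 - N) * X * (1 - P)‖ := by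
  set m := max ‖N * X * P‖ ‖(1 - N) * X * (1 - P)‖ with hm
  have hm0 : 0 ≤ m := (norm_nonneg _).trans (le_max_left _ _)
  refine ContinuousLinearMap.opNorm_le_bound _ hm0 fun u => ?_
  have hP2 : P * P = P := hP.isIdempotentElem
  have hQ2 : (1 - P) * (1 - P) = 1 - P := hP.one_sub.isIdempotentElem
  have e1 : (N * X * P) u = (N * X * P) (P u) := by
    rw [← mul_apply_eq_comp (N * X * P) P, mul_assoc (N * X), hP2]
  have e2 : ((1 - N) * X * (1 - P)) u = ((1 - N) * X * (1 - P)) ((1 - P) u) := by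
    rw [← mul_apply_eq_comp ((1 - N) * X * (1 - P)) (1 - P), mul_assoc ((1 - N) * X), hQ2]
  have n1 : ‖(N * X * P) u‖ ≤ m * ‖P u‖ := by
    rw [e1]
    exact (ContinuousLinearMap.le_opNorm _ _).trans (by gcongr; exact le_max_left _ _)
  have n2 : ‖((1 - N) * X * (1 - P)) u‖ ≤ m * ‖(1 - P) u‖ := by
    rw [e2]
    exact (ContinuousLinearMap.le_opNorm _ _).trans (by gcongr; exact le_max_right _ _)
  have h := norm_add_sq (𝕜 := ℂ) ((N * X * P) u) (((1 - N) * X * (1 - P)) u)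
  have h0 : inner ℂ ((N * X * P) u) (((1 - N) * X * (1 - P)) u) = 0 :=
    IsStarProjection.inner_apply_one_sub hN (X (P u)) (X ((1 - P) u))
  rw [h0] at h
  have hu := norm_sq_eq_add_of_isStarProjection hP u
  refine abs_le_of_sq_le_sq' ?_ (by positivity) |>.2
  rw [add_apply, h, mul_pow, hu]
  have s1 := pow_le_pow_left₀ (norm_nonneg _) n1 2
  have s2 := pow_le_pow_left₀ (norm_nonneg _) n2 2
  simp only [map_zero, mul_zero, add_zero]
  rw [mul_pow] at s1 s2
  linarith

lemma norm_le_max_add_max (hN : IsStarProjection N) (hP : IsStarProjection P) (X : H →L[ℂ] H) :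
    ‖X‖ ≤ max ‖N * X * P‖ ‖(1 - N) * X * (1 - P)‖
      + max ‖N * X * (1 - P)‖ ‖(1 - N) * X * P‖ := by
  have e : X = (N * X * P + (1 - N) * X * (1 - P))
      + (N * X * (1 - P) + (1 - N) * X * (1 - (1 - P))) := by noncomm_ring
  conv_lhs => rw [e]
  refine (norm_add_le _ _).trans (add_le_add (norm_diag_le_max hN hP X) ?_)
  have := norm_diag_le_max hN hP.one_sub X
  rwa [sub_sub_cancel] at this ⊢

lemma norm_projection_mul_mul_le (hN : IsStarProjection N) (hP : IsStarProjection P)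
    (X : H →L[ℂ] H) : ‖N * X * P‖ ≤ ‖X‖ := by
  refine (norm_mul_le _ _).trans ((mul_le_of_le_one_right (norm_nonneg _) (hP.norm_le P)).trans ?_)
  exact (norm_mul_le _ _).trans (mul_le_of_le_one_left (norm_nonneg _) (hN.norm_le N))

/-- A commutator with a projection is off-diagonal and its blocks are, up to sign, those of `X`;
this saves the factor 2 of the triangle inequality. -/
lemma norm_mul_sub_mul_le (hP : IsStarProjection P) (X : H →L[ℂ] H) :
    ‖P * X - X * P‖ ≤ ‖X‖ := by
  have hP2 : P * P = P := hP.isIdempotentElem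
  have hP3 : ∀ x, P * (P * x) = P * x := fun x => by rw [← mul_assoc, hP2]
  have h := norm_diag_le_max hP hP.one_sub (P * X - X * P)
  have e : P * (P * X - X * P) * (1 - P) + (1 - P) * (P * X - X * P) * (1 - (1 - P))
      = P * X - X * P := by
    simp only [mul_sub, sub_mul, mul_one, one_mul, mul_assoc, hP2, hP3]
    abel
  have e1 : P * (P * X - X * P) * (1 - P) = P * X * (1 - P) := by
    simp only [mul_sub, sub_mul, mul_one, mul_assoc, hP2, hP3]
    abel
  have e2 : (1 - P) * (P * X - X * P) * (1 - (1 - P)) = -((1 - P) * X * P) := by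
    simp only [mul_sub, sub_mul, mul_one, one_mul, mul_assoc, hP2, hP3]
    abel
  rw [e, e1, e2, norm_neg] at h
  exact h.trans (max_le (norm_projection_mul_mul_le hP hP.one_sub X)
    (norm_projection_mul_mul_le hP.one_sub hP X))

lemma norm_sub_le_max (hP : IsStarProjection P) (hP' : IsStarProjection P') :
    ‖P' - P‖ ≤ max ‖P' * (1 - P)‖ ‖(1 - P') * P‖ := by
  have hP2 : P * P = P := hP.isIdempotentElem
  have hP2' : P' * P' = P' := hP'.isIdempotentElem
  have hP3 : ∀ x, P' * (P' * x) = P' * x := fun x => by rw [← mul_assoc, hP2']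
  have h := norm_diag_le_max hP' hP.one_sub (P' - P)
  have e1 : P' * (P' - P) * (1 - P) = P' * (1 - P) := by
    simp only [mul_sub, sub_mul, mul_one, mul_assoc, hP2, hP2']
    abel
  have e2 : (1 - P') * (P' - P) * (1 - (1 - P)) = -((1 - P') * P) := by
    simp only [mul_sub, sub_mul, mul_one, one_mul, mul_assoc, hP2, hP2']
    abel
  rw [e1, e2, norm_neg] at h
  refine le_of_eq_of_le ?_ h
  congr 1
  noncomm_ring

lemma norm_mul_one_sub_le (hP : IsStarProjection P) (hP' : IsStarProjection P') :
    ‖P' * (1 - P)‖ ≤ ‖P' - P‖ := by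
  have hP2 : P * P = P := hP.isIdempotentElem
  have hP2' : P' * P' = P' := hP'.isIdempotentElem
  have hP3 : ∀ x, P' * (P' * x) = P' * x := fun x => by rw [← mul_assoc, hP2']
  have e1 : P' * (1 - P) = P' * (P' - P) * (1 - P) := by
    simp only [mul_sub, sub_mul, mul_one, mul_assoc, hP2, hP2']
    abel
  rw [e1]
  exact norm_projection_mul_mul_le hP' hP.one_sub _

end Blocks

/-! ### The polar decomposition of `opS` -/

section Polar

variable {P P' : H →L[ℂ] H}

lemma opS_mul_star (hP : IsStarProjection P) (hP' : IsStarProjection P') :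
    opS P' P * star (opS P' P) = 1 - (P' - P) * (P' - P) := by
  have hP2 : P * P = P := hP.isIdempotentElem
  have hP2' : P' * P' = P' := hP'.isIdempotentElem
  have hP3 : ∀ x, P' * (P' * x) = P' * x := fun x => by rw [← mul_assoc, hP2']
  have hP4 : ∀ x, P * (P * x) = P * x := fun x => by rw [← mul_assoc, hP2]
  simp only [opS, star_add, star_mul, star_sub, star_one, hP.isSelfAdjoint.star_eq,
    hP'.isSelfAdjoint.star_eq, mul_sub, sub_mul, mul_add, add_mul, mul_one, one_mul, mul_assoc, hP2,
    hP2', hP4]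
  abel

/-- Since 1 - D² = v² with D = P' - P, multiplication by v⁻¹ turns this into V = v - Y, which
separates the second-order part of V - 1 from the first-order part. -/
lemma opS_eq (hP : IsStarProjection P) (hP' : IsStarProjection P') :
    opS P' P = 1 - (P' - P) * (P' - P) - (P * P' - P' * P) := by
  have hP2 : P * P = P := hP.isIdempotentElem
  have hP2' : P' * P' = P' := hP'.isIdempotentElem
  simp only [opS, mul_sub, sub_mul, mul_one, one_mul, hP2, hP2']
  abel

lemma abs_le_of_mem_spectrum {D : H →L[ℂ] H} {z : ℝ} (hz : ‖D‖ ≤ z) {x : ℝ}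
    (hx : x ∈ spectrum ℝ D) : |x| ≤ z := by
  rcases subsingleton_or_nontrivial (H →L[ℂ] H) with h | h
  · simp [spectrum.of_subsingleton] at hx
  · exact (spectrum.norm_le_norm_of_mem hx).trans hz

/-- As a function of the self-adjoint D = P' - P, the operator v is controlled by scalar estimates
on [-z, z]. -/
lemma opv_eq_cfc (hP : IsStarProjection P) (hP' : IsStarProjection P') (h1 : ‖P' - P‖ ≤ 1) :
    opv P' P = cfc (fun x : ℝ => √(1 - x ^ 2)) (P' - P) := by
  have hD : IsSelfAdjoint (P' - P) := hP'.isSelfAdjoint.sub hP.isSelfAdjoint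
  have hc : Continuous fun x : ℝ => √(1 - x ^ 2) := by fun_prop
  refine CFC.sqrt_unique ?_ (cfc_nonneg fun x _ => Real.sqrt_nonneg _)
  rw [opS_mul_star hP hP', ← cfc_mul _ _ _ hc.continuousOn hc.continuousOn, ← sq,
    ← cfc_const_one ℝ (P' - P), ← cfc_pow_id (R := ℝ) (P' - P) 2,
    ← cfc_sub _ _ _ (by fun_prop) (by fun_prop)]
  refine cfc_congr fun x hx => ?_
  have := abs_le_of_mem_spectrum h1 hx
  have h2 : x ^ 2 ≤ 1 := (sq_le_one_iff_abs_le_one x).mpr this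
  exact Real.mul_self_sqrt (by linarith)

/-- `v⁻¹ [P, P']`, up to a sign the part of the unitary `opV P' P` that is off-diagonal with respect
to `P` (and to `P'`). -/
def opY (P' P : H →L[ℂ] H) : H →L[ℂ] H :=
  Ring.inverse (opv P' P) * (P * P' - P' * P)

variable {z : ℝ}

lemma sqrt_one_sub_sq_le {x z : ℝ} (h : |x| ≤ z) : √(1 - z ^ 2) ≤ √(1 - x ^ 2) :=
  Real.sqrt_le_sqrt (by nlinarith [abs_nonneg x, sq_abs x])

lemma one_sub_sq_pos {z : ℝ} (h0 : 0 ≤ z) (h : z < 1) : 0 < 1 - z ^ 2 := by nlinarith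

lemma norm_one_sub_opv_le (hP : IsStarProjection P) (hP' : IsStarProjection P')
    (hz : ‖P' - P‖ ≤ z) (hz1 : z < 1) : ‖1 - opv P' P‖ ≤ 1 - √(1 - z ^ 2) := by
  have hD : IsSelfAdjoint (P' - P) := hP'.isSelfAdjoint.sub hP.isSelfAdjoint
  have hs : √(1 - z ^ 2) ≤ 1 := Real.sqrt_le_one.mpr (by nlinarith)
  rw [opv_eq_cfc hP hP' (hz.trans hz1.le), ← cfc_const_one ℝ (P' - P),
    ← cfc_sub _ _ _ (by fun_prop) (by fun_prop)]
  refine norm_cfc_le (by linarith) fun x hx => ?_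
  have h1 := sqrt_one_sub_sq_le (abs_le_of_mem_spectrum hz hx)
  have h2 : √(1 - x ^ 2) ≤ 1 := Real.sqrt_le_one.mpr (by nlinarith)
  rw [Real.norm_of_nonneg (by linarith)]
  linarith

lemma opv_inverse (hP : IsStarProjection P) (hP' : IsStarProjection P')
    (hz : ‖P' - P‖ ≤ z) (hz1 : z < 1) :
    opv P' P * Ring.inverse (opv P' P) = 1 ∧ Ring.inverse (opv P' P) * opv P' P = 1 ∧
      ‖Ring.inverse (opv P' P)‖ ≤ D₁ z ∧ ‖Ring.inverse (opv P' P) - 1‖ ≤ D₁ z - 1 := by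
  have hz0 : 0 ≤ z := (norm_nonneg _).trans hz
  have hD : IsSelfAdjoint (P' - P) := hP'.isSelfAdjoint.sub hP.isSelfAdjoint
  have hpos : ∀ x ∈ spectrum ℝ (P' - P), 0 < √(1 - x ^ 2) := fun x hx =>
    (Real.sqrt_pos.mpr (one_sub_sq_pos hz0 hz1)).trans_le
      (sqrt_one_sub_sq_le (abs_le_of_mem_spectrum hz hx))
  have hle : ∀ x ∈ spectrum ℝ (P' - P), (√(1 - x ^ 2))⁻¹ ≤ D₁ z := fun x hx => by
    rw [D₁, one_div]
    exact inv_anti₀ (Real.sqrt_pos.mpr (one_sub_sq_pos hz0 hz1))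
      (sqrt_one_sub_sq_le (abs_le_of_mem_spectrum hz hx))
  have hge : ∀ x ∈ spectrum ℝ (P' - P), 1 ≤ (√(1 - x ^ 2))⁻¹ := fun x hx =>
    one_le_inv_iff₀.mpr ⟨hpos x hx, Real.sqrt_le_one.mpr (by nlinarith)⟩
  have hD1 : 1 ≤ D₁ z := by
    rw [D₁, one_div]
    exact one_le_inv_iff₀.mpr ⟨Real.sqrt_pos.mpr (one_sub_sq_pos hz0 hz1),
      Real.sqrt_le_one.mpr (by nlinarith)⟩
  have hc : ContinuousOn (fun x : ℝ => √(1 - x ^ 2)) (spectrum ℝ (P' - P)) := by fun_prop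
  have hci : ContinuousOn (fun x : ℝ => (√(1 - x ^ 2))⁻¹) (spectrum ℝ (P' - P)) :=
    hc.inv₀ fun x hx => (hpos x hx).ne'
  set w := cfc (fun x : ℝ => (√(1 - x ^ 2))⁻¹) (P' - P) with hw
  have m1 : opv P' P * w = 1 := by
    rw [opv_eq_cfc hP hP' (hz.trans hz1.le), hw, ← cfc_mul _ _ _ hc hci,
      ← cfc_const_one ℝ (P' - P)]
    exact cfc_congr fun x hx => mul_inv_cancel₀ (hpos x hx).ne'
  have m2 : w * opv P' P = 1 := by
    rw [opv_eq_cfc hP hP' (hz.trans hz1.le), hw, ← cfc_mul _ _ _ hci hc,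
      ← cfc_const_one ℝ (P' - P)]
    exact cfc_congr fun x hx => inv_mul_cancel₀ (hpos x hx).ne'
  have e : Ring.inverse (opv P' P) = w := Ring.inverse_unit ⟨opv P' P, w, m1, m2⟩
  rw [e]
  refine ⟨m1, m2, ?_, ?_⟩
  · refine norm_cfc_le (by linarith) fun x hx => ?_
    rw [Real.norm_of_nonneg (by linarith [hge x hx])]
    exact hle x hx
  · rw [hw, ← cfc_const_one ℝ (P' - P), ← cfc_sub _ _ _ hci (by fun_prop)]
    refine norm_cfc_le (by linarith) fun x hx => ?_
    rw [Real.norm_of_nonneg (by linarith [hge x hx])]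
    linarith [hle x hx]

lemma opv_mul_self (hP : IsStarProjection P) (hP' : IsStarProjection P') :
    opv P' P * opv P' P = 1 - (P' - P) * (P' - P) := by
  rw [opv, CFC.sqrt_mul_sqrt_self _ (mul_star_self_nonneg _), opS_mul_star hP hP']

lemma commute_opv {B : H →L[ℂ] H} (hP : IsStarProjection P) (hP' : IsStarProjection P')
    (h : Commute (1 - (P' - P) * (P' - P)) B) : Commute (opv P' P) B := by
  rw [← opS_mul_star hP hP'] at h
  exact h.cfcₙ_nnreal _

lemma commute_opv_left (hP : IsStarProjection P) (hP' : IsStarProjection P') :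
    Commute (opv P' P) P := by
  refine commute_opv hP hP' ?_
  have hP2 : P * P = P := hP.isIdempotentElem
  have hP2' : P' * P' = P' := hP'.isIdempotentElem
  have hP4 : ∀ x, P * (P * x) = P * x := fun x => by rw [← mul_assoc, hP2]
  rw [Commute, SemiconjBy]
  simp only [mul_sub, sub_mul, mul_one, one_mul, mul_assoc, hP2, hP2', hP4]
  abel

lemma commute_opv_right (hP : IsStarProjection P) (hP' : IsStarProjection P') :
    Commute (opv P' P) P' := by
  refine commute_opv hP hP' ?_
  have hP2 : P * P = P := hP.isIdempotentElem
  have hP2' : P' * P' = P' := hP'.isIdempotentElem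
  have hP4 : ∀ x, P' * (P' * x) = P' * x := fun x => by rw [← mul_assoc, hP2']
  rw [Commute, SemiconjBy]
  simp only [mul_sub, sub_mul, mul_one, one_mul, mul_assoc, hP2, hP2', hP4]
  abel

lemma commute_ringInverse {𝓐 : Type*} [Ring 𝓐] {a b : 𝓐} (h : Commute a b) :
    Commute (Ring.inverse a) b := by
  by_cases ha : IsUnit a
  · obtain ⟨u, rfl⟩ := ha
    rw [Ring.inverse_unit]
    exact Commute.units_inv_left h
  · rw [Ring.inverse_non_unit _ ha]
    exact Commute.zero_left b

end Polar

section Polar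

variable {P P' : H →L[ℂ] H} {z : ℝ}

lemma opV_eq (hP : IsStarProjection P) (hP' : IsStarProjection P') (hz : ‖P' - P‖ ≤ z)
    (hz1 : z < 1) : opV P' P = opv P' P - opY P' P := by
  rw [opV, opS_eq hP hP', ← opv_mul_self hP hP', mul_sub, ← mul_assoc,
    (opv_inverse hP hP' hz hz1).2.1, one_mul, opY]

lemma commute_opv_commutator (hP : IsStarProjection P) (hP' : IsStarProjection P') :
    Commute (opv P' P) (P * P' - P' * P) := by
  have h1 := commute_opv_left hP hP'
  have h2 := commute_opv_right hP hP'
  exact (h1.mul_right h2).sub_right (h2.mul_right h1)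

lemma commute_opv_opY (hP : IsStarProjection P) (hP' : IsStarProjection P') :
    Commute (opv P' P) (opY P' P) :=
  (commute_ringInverse (Commute.refl _)).symm.mul_right (commute_opv_commutator hP hP')

lemma star_opv : star (opv P' P) = opv P' P :=
  (IsSelfAdjoint.of_nonneg (CFC.sqrt_nonneg _)).star_eq

lemma star_opY (hP : IsStarProjection P) (hP' : IsStarProjection P') :
    star (opY P' P) = -opY P' P := by
  have h : star (P * P' - P' * P) = -(P * P' - P' * P) := by
    simp only [star_sub, star_mul, hP.isSelfAdjoint.star_eq, hP'.isSelfAdjoint.star_eq, neg_sub]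
  rw [opY, star_mul, h, ← Ring.inverse_star, star_opv, neg_mul,
    (commute_ringInverse (commute_opv_commutator hP hP')).eq]

lemma star_opV (hP : IsStarProjection P) (hP' : IsStarProjection P') (hz : ‖P' - P‖ ≤ z)
    (hz1 : z < 1) : star (opV P' P) = opv P' P + opY P' P := by
  rw [opV_eq hP hP' hz hz1, star_sub, star_opv, star_opY hP hP', sub_neg_eq_add]

lemma opV_mul_star (hP : IsStarProjection P) (hP' : IsStarProjection P') (hz : ‖P' - P‖ ≤ z)
    (hz1 : z < 1) : opV P' P * star (opV P' P) = 1 := by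
  obtain ⟨h1, h2, -, -⟩ := opv_inverse hP hP' hz hz1
  have e : star (opV P' P) = star (opS P' P) * Ring.inverse (opv P' P) := by
    rw [opV, star_mul, ← Ring.inverse_star, star_opv]
  rw [e, opV, mul_assoc, ← mul_assoc (opS P' P), opS_mul_star hP hP', ← opv_mul_self hP hP',
    mul_assoc, h1, mul_one, h2]

lemma opV_mem_unitary (hP : IsStarProjection P) (hP' : IsStarProjection P') (hz : ‖P' - P‖ ≤ z)
    (hz1 : z < 1) : opV P' P ∈ unitary (H →L[ℂ] H) := by
  have h := opV_mul_star hP hP' hz hz1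
  refine Unitary.mem_iff.mpr ⟨?_, h⟩
  rw [← h, star_opV hP hP' hz hz1, opV_eq hP hP' hz hz1]
  simp only [mul_sub, sub_mul, add_mul, mul_add, (commute_opv_opY hP hP').eq]
  abel

/-- Unitarity of V = v - Y, with v self-adjoint, Y skew-adjoint and the two commuting, says v² - Y²
= 1, while v² = 1 - D². -/
lemma opY_mul_opY (hP : IsStarProjection P) (hP' : IsStarProjection P') (hz : ‖P' - P‖ ≤ z)
    (hz1 : z < 1) : opY P' P * opY P' P = -((P' - P) * (P' - P)) := by
  have h := opV_mul_star hP hP' hz hz1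
  rw [star_opV hP hP' hz hz1, opV_eq hP hP' hz hz1, sub_mul, mul_add, mul_add,
    (commute_opv_opY hP hP').eq, opv_mul_self hP hP'] at h
  rw [← sub_eq_zero] at h
  rw [← sub_eq_zero, ← neg_eq_zero, ← h]
  abel

lemma norm_opY (hP : IsStarProjection P) (hP' : IsStarProjection P') (hz : ‖P' - P‖ ≤ z)
    (hz1 : z < 1) : ‖opY P' P‖ = ‖P' - P‖ := by
  have hD : star (P' - P) = P' - P := (hP'.isSelfAdjoint.sub hP.isSelfAdjoint).star_eq
  have h1 : ‖opY P' P‖ * ‖opY P' P‖ = ‖P' - P‖ * ‖P' - P‖ := by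
    rw [← CStarRing.norm_star_mul_self, ← CStarRing.norm_star_mul_self, star_opY hP hP', hD,
      neg_mul, opY_mul_opY hP hP' hz hz1, neg_neg]
  exact (mul_self_inj (norm_nonneg _) (norm_nonneg _)).mp h1

/-- Off-diagonality is with respect to the new projection `P'`; hence the commutator equation for Y
will involve the walk operator at the later time. -/
lemma mul_opY_right (hP : IsStarProjection P) (hP' : IsStarProjection P') :
    P' * opY P' P = opY P' P * (1 - P') := by
  have hP2 : P' * P' = P' := hP'.isIdempotentElem
  have hP4 : ∀ x, P' * (P' * x) = P' * x := fun x => by rw [← mul_assoc, hP2]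
  rw [opY, ← mul_assoc, ← (commute_ringInverse (commute_opv_right hP hP')).eq, mul_assoc, mul_assoc]
  congr 1
  simp only [mul_sub, sub_mul, mul_one, mul_assoc, hP2, hP4]
  abel

lemma D₁_one_le (hz0 : 0 ≤ z) (hz1 : z < 1) : 1 ≤ D₁ z := by
  rw [D₁, one_div]
  exact one_le_inv_iff₀.mpr ⟨Real.sqrt_pos.mpr (one_sub_sq_pos hz0 hz1),
    Real.sqrt_le_one.mpr (by nlinarith)⟩

lemma D₂_eq (hz0 : 0 ≤ z) (hz1 : z < 1) : D₂ z = (1 + z) * D₁ z - 1 := by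
  have h1 : 0 < 1 - z := by linarith
  have h2 : 0 < 1 + z := by linarith
  rw [D₂, D₁, show (1 - z ^ 2 : ℝ) = (1 + z) * (1 - z) by ring, Real.sqrt_div h2.le,
    Real.sqrt_mul h2.le]
  have s1 := Real.sqrt_pos.mpr h1
  have s2 := Real.sqrt_pos.mpr h2
  have s3 := Real.mul_self_sqrt h2.le
  field_simp
  linear_combination s3

lemma le_D₂ (hz0 : 0 ≤ z) (hz1 : z < 1) : z ≤ D₂ z := by
  rw [D₂_eq hz0 hz1]
  nlinarith [D₁_one_le hz0 hz1]

lemma D₃_eq (hz0 : 0 ≤ z) (hz1 : z < 1) : D₃ z = z * D₁ z ^ 3 := by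
  have h := one_sub_sq_pos hz0 hz1
  have e : (1 - z ^ 2) ^ (3 / 2 : ℝ) = √(1 - z ^ 2) ^ 3 := by
    rw [Real.sqrt_eq_rpow, ← Real.rpow_natCast ((1 - z ^ 2) ^ (1 / 2 : ℝ)) 3,
      ← Real.rpow_mul h.le]
    norm_num
  rw [D₃, D₁, e, one_div, inv_pow, div_eq_mul_inv]

/-- V - 1 = v⁻¹(S - 1) + (v⁻¹ - 1), and S - 1 is -D times the reflection 1 - 2P, so that its norm is
at most z. The sum z`D₁` + (`D₁` - 1) is `D₂`. -/
lemma norm_opV_sub_one_le (hP : IsStarProjection P) (hP' : IsStarProjection P')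
    (hz : ‖P' - P‖ ≤ z) (hz1 : z < 1) : ‖opV P' P - 1‖ ≤ D₂ z := by
  have hz0 : 0 ≤ z := (norm_nonneg _).trans hz
  obtain ⟨-, -, h3, h4⟩ := opv_inverse hP hP' hz hz1
  have hP2 : P * P = P := hP.isIdempotentElem
  have e : opS P' P - 1 = -((P' - P) * (1 - (P + P))) := by
    simp only [opS, mul_sub, sub_mul, mul_one, one_mul, mul_add, hP2]
    abel
  have hu : ‖1 - (P + P)‖ ≤ 1 := by
    have := norm_diag_le_max hP hP (1 - (P + P))
    have e1 : P * (1 - (P + P)) * P = -P := by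
      simp only [mul_sub, sub_mul, mul_one, mul_add, add_mul, hP2]
      abel
    have e2 : (1 - P) * (1 - (P + P)) * (1 - P) = 1 - P := by
      simp only [mul_sub, sub_mul, mul_one, one_mul, mul_add, add_mul, hP2]
      abel
    rw [e1, e2, norm_neg] at this
    calc ‖1 - (P + P)‖ = ‖-P + (1 - P)‖ := by congr 1; abel
      _ ≤ _ := this.trans (max_le (hP.norm_le P) (hP.one_sub.norm_le _))
  have hS : ‖opS P' P - 1‖ ≤ z := by
    rw [e, norm_neg]
    exact (norm_mul_le _ _).trans (by nlinarith [norm_nonneg (P' - P)])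
  have e3 : opV P' P - 1 = Ring.inverse (opv P' P) * (opS P' P - 1)
      + (Ring.inverse (opv P' P) - 1) := by
    rw [opV]; noncomm_ring
  rw [e3, D₂_eq hz0 hz1]
  have := (norm_mul_le (Ring.inverse (opv P' P)) (opS P' P - 1)).trans
    (mul_le_mul h3 hS (norm_nonneg _) ((norm_nonneg _).trans h3))
  linarith [norm_add_le (Ring.inverse (opv P' P) * (opS P' P - 1))
    (Ring.inverse (opv P' P) - 1)]

end Polar

/-! ### Lipschitz dependence of the polar factors on the projections -/

section Difference

variable {P N R : H →L[ℂ] H} {z : ℝ}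

/-- Square roots of `1 - D²` depend on `D` in a Lipschitz way. -/
lemma norm_opv_sub_opv_le {P₀ P₀' P₁ P₁' : H →L[ℂ] H} (h0 : IsStarProjection P₀)
    (h0' : IsStarProjection P₀') (h1 : IsStarProjection P₁) (h1' : IsStarProjection P₁')
    (hz : ‖P₀' - P₀‖ ≤ z) (hz' : ‖P₁' - P₁‖ ≤ z) (hz1 : z < 1) :
    ‖opv P₀' P₀ - opv P₁' P₁‖ ≤ z * D₁ z * ‖(P₁' - P₁) - (P₀' - P₀)‖ := by
  have hz0 : 0 ≤ z := (norm_nonneg _).trans hz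
  set X := opv P₀' P₀ - opv P₁' P₁ with hX
  set a := √(1 - z ^ 2) with ha
  have ha0 : 0 < a := Real.sqrt_pos.mpr (one_sub_sq_pos hz0 hz1)
  have n0 := norm_one_sub_opv_le h0 h0' hz hz1
  have n1 := norm_one_sub_opv_le h1 h1' hz' hz1
  -- The difference X of the roots solves v₁X + Xv₀ = v₀² - v₁² = D₁² - D₀². Both roots are within 1
  -- - a of the identity, so the terms in X on the right are absorbed.
  have e : (2 : ℝ) • X = (1 - opv P₁' P₁) * X + X * (1 - opv P₀' P₀)
      + ((P₁' - P₁) * ((P₁' - P₁) - (P₀' - P₀)) + ((P₁' - P₁) - (P₀' - P₀)) * (P₀' - P₀)) := by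
    have s0 := opv_mul_self h0 h0'
    have s1 := opv_mul_self h1 h1'
    have e1 : opv P₁' P₁ * X + X * opv P₀' P₀
        = opv P₀' P₀ * opv P₀' P₀ - opv P₁' P₁ * opv P₁' P₁ := by rw [hX]; noncomm_ring
    rw [s0, s1] at e1
    have e2 : (1 - opv P₁' P₁) * X + X * (1 - opv P₀' P₀)
        = (2 : ℝ) • X - (opv P₁' P₁ * X + X * opv P₀' P₀) := by
      rw [two_smul]; noncomm_ring
    rw [e2, e1]
    noncomm_ring
  have hn : 2 * ‖X‖ ≤ (1 - a) * ‖X‖ + ‖X‖ * (1 - a)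
      + (z * ‖(P₁' - P₁) - (P₀' - P₀)‖ + ‖(P₁' - P₁) - (P₀' - P₀)‖ * z) := by
    calc 2 * ‖X‖ = ‖(2 : ℝ) • X‖ := by rw [norm_smul]; norm_num
      _ ≤ _ := by
        rw [e]
        refine (norm_add_le _ _).trans (add_le_add ((norm_add_le _ _).trans (add_le_add ?_ ?_))
          ((norm_add_le _ _).trans (add_le_add ?_ ?_)))
        · exact (norm_mul_le _ _).trans (mul_le_mul_of_nonneg_right n1 (norm_nonneg _))
        · exact (norm_mul_le _ _).trans (mul_le_mul_of_nonneg_left n0 (norm_nonneg _))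
        · exact (norm_mul_le _ _).trans (mul_le_mul_of_nonneg_right hz' (norm_nonneg _))
        · exact (norm_mul_le _ _).trans (mul_le_mul_of_nonneg_left hz (norm_nonneg _))
  rw [D₁, mul_one_div, div_mul_eq_mul_div, le_div_iff₀ ha0]
  linarith

lemma norm_inverse_opv_sub_le {P₀ P₀' P₁ P₁' : H →L[ℂ] H} (h0 : IsStarProjection P₀)
    (h0' : IsStarProjection P₀') (h1 : IsStarProjection P₁) (h1' : IsStarProjection P₁')
    (hz : ‖P₀' - P₀‖ ≤ z) (hz' : ‖P₁' - P₁‖ ≤ z) (hz1 : z < 1) :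
    ‖Ring.inverse (opv P₁' P₁) - Ring.inverse (opv P₀' P₀)‖
      ≤ D₃ z * ‖(P₁' - P₁) - (P₀' - P₀)‖ := by
  have hz0 : 0 ≤ z := (norm_nonneg _).trans hz
  obtain ⟨a1, a2, a3, -⟩ := opv_inverse h0 h0' hz hz1
  obtain ⟨b1, b2, b3, -⟩ := opv_inverse h1 h1' hz' hz1
  have e : Ring.inverse (opv P₁' P₁) - Ring.inverse (opv P₀' P₀)
      = Ring.inverse (opv P₁' P₁) * (opv P₀' P₀ - opv P₁' P₁) * Ring.inverse (opv P₀' P₀) := by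
    rw [mul_sub, sub_mul, mul_assoc, a1, b2, mul_one, one_mul]
  have hD : 0 ≤ D₁ z := zero_le_one.trans (D₁_one_le hz0 hz1)
  rw [e, D₃_eq hz0 hz1]
  calc _ ≤ D₁ z * (z * D₁ z * ‖(P₁' - P₁) - (P₀' - P₀)‖) * D₁ z := by
        refine (norm_mul_le _ _).trans ?_
        gcongr
        refine (norm_mul_le _ _).trans ?_
        gcongr
        exact norm_opv_sub_opv_le h0 h0' h1 h1' hz hz' hz1
    _ = _ := by ring

/-- Both commutators are commutators with the middle projection: [P, N] = [P, N - P] and [R, P] =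
[P, P - R]. Their difference thus contains only the second difference of the projections. -/
lemma norm_opY_sub_opY_le (hR : IsStarProjection R) (hP : IsStarProjection P)
    (hN : IsStarProjection N) {z₀ : ℝ} (h0 : ‖P - R‖ ≤ z₀) (h1 : ‖N - P‖ ≤ z) (hz₀ : z₀ ≤ z)
    (hz1 : z < 1) :
    ‖opY N P - opY P R‖ ≤ (D₃ z + D₁ z₀) * ‖(N - P) - (P - R)‖ := by
  have hz0 : 0 ≤ z := (norm_nonneg _).trans h1
  have e : opY N P - opY P R
      = (Ring.inverse (opv N P) - Ring.inverse (opv P R)) * (P * (N - P) - (N - P) * P)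
        + Ring.inverse (opv P R) * (P * ((N - P) - (P - R)) - ((N - P) - (P - R)) * P) := by
    simp only [opY]
    noncomm_ring
  have h3 := (opv_inverse hR hP h0 (hz₀.trans_lt hz1)).2.2.1
  rw [e, add_mul]
  refine (norm_add_le _ _).trans (add_le_add ?_ ?_)
  · refine (norm_mul_le _ _).trans ?_
    refine (mul_le_of_le_one_right (norm_nonneg _)
      ((norm_mul_sub_mul_le hP _).trans (h1.trans hz1.le))).trans ?_
    exact norm_inverse_opv_sub_le hR hP hP hN (h0.trans hz₀) h1 hz1
  · refine (norm_mul_le _ _).trans ?_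
    exact mul_le_mul h3 (norm_mul_sub_mul_le hP _) (norm_nonneg _) ((norm_nonneg _).trans h3)

end Difference

/-! ### Consequences of a gap -/

/-- The Sylvester equation of the pair `L`, `R` has bounded solutions on both off-diagonal blocks
with respect to the projections `E`, `G`. -/
def GapBound (L E R G : H →L[ℂ] H) (κ : ℝ) : Prop :=
  SylvesterBound L E R (1 - G) κ ∧ SylvesterBound L (1 - E) R G κ

variable {κ : ℝ}

lemma SylvesterBound.norm_block_le {L E R G : H →L[ℂ] H} (h : SylvesterBound L E R G κ)
    (hE : IsStarProjection E) (hG : IsStarProjection G) (hLE : L * E = E * L)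
    (hRG : R * G = G * R) (X : H →L[ℂ] H) :
    ‖E * X * G‖ ≤ κ * ‖E * (X * R - L * X) * G‖ := by
  have hE2 : E * E = E := hE.isIdempotentElem
  have hG2 : G * G = G := hG.isIdempotentElem
  refine (h (E * X * G) ?_ ?_).trans_eq ?_
  · rw [← mul_assoc, ← mul_assoc, hE2]
  · rw [mul_assoc, hG2]
  · congr 2
    rw [mul_assoc _ G R, ← hRG, ← mul_assoc L, ← mul_assoc L, hLE]
    noncomm_ring

lemma one_sub_commute {𝓐 : Type*} [Ring 𝓐] {L E : 𝓐} (h : L * E = E * L) :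
    L * (1 - E) = (1 - E) * L := by
  rw [mul_sub, sub_mul, h, mul_one, one_mul]

/-- Apply the Sylvester bound to the off-diagonal blocks of X = 1, for which XR - LX is just R - L.
-/
lemma GapBound.norm_sub_le {L E R G : H →L[ℂ] H} (h : GapBound L E R G κ) (hκ : 0 ≤ κ)
    (hE : IsStarProjection E) (hG : IsStarProjection G) (hLE : L * E = E * L)
    (hRG : R * G = G * R) : ‖E - G‖ ≤ κ * ‖R - L‖ := by
  refine (norm_sub_le_max hG hE).trans (max_le ?_ ?_)
  · have := h.1.norm_block_le hE hG.one_sub hLE (one_sub_commute hRG) 1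
    rw [mul_one, one_mul, mul_one] at this
    exact this.trans (by gcongr; exact norm_projection_mul_mul_le hE hG.one_sub _)
  · have := h.2.norm_block_le hE.one_sub hG (one_sub_commute hLE) hRG 1
    rw [mul_one, one_mul, mul_one] at this
    exact this.trans (by gcongr; exact norm_projection_mul_mul_le hE.one_sub hG _)

/-! ### Second differences of spectral projections -/

section SecondDifference

variable {WR WP WN R P N : H →L[ℂ] H}

/-- A discrete product rule: as each projection commutes with its own walk operator, the Sylvester
right-hand side for the second difference reduces to the second difference of W and products of two
first differences. -/
lemma norm_secondDiff_offDiag_le (h : SylvesterBound WN N WP (1 - P) κ) (hκ : 0 ≤ κ)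
    (hR : IsStarProjection R) (hP : IsStarProjection P) (hN : IsStarProjection N)
    (cR : WR * R = R * WR) (cP : WP * P = P * WP) (cN : WN * N = N * WN) :
    ‖N * (N - P - (P - R)) * (1 - P)‖ ≤ κ * (‖WN - WP - (WP - WR)‖ + ‖N - R‖ * ‖WP - WR‖
      + ‖WN - WR‖ * ‖P - R‖) := by
  have hP2 : P * P = P := hP.isIdempotentElem
  have hN2 : N * N = N := hN.isIdempotentElem
  have hP3 : ∀ x, P * (P * x) = P * x := fun x => by rw [← mul_assoc, hP2]
  have hN3 : ∀ x, N * (N * x) = N * x := fun x => by rw [← mul_assoc, hN2]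
  have cR' : ∀ x, WR * (R * x) = R * (WR * x) := fun x => by rw [← mul_assoc, cR, mul_assoc]
  refine (h.norm_block_le hN hP.one_sub cN (one_sub_commute cP) _).trans ?_
  gcongr
  have e : N * ((N - P - (P - R)) * WP - WN * (N - P - (P - R))) * (1 - P)
      = -(N * (WN - WP - (WP - WR)) * (1 - P)) - (N * (1 - R)) * (WP - WR) * (1 - P)
        - N * (WN - WR) * (R * (1 - P)) := by
    simp only [mul_sub, sub_mul, mul_one, mul_assoc, cR, cP, cN, cR', hP2, hN3, hP3]
    abel
  rw [e]
  refine (norm_sub_le _ _).trans (add_le_add ((norm_sub_le _ _).trans (add_le_add ?_ ?_)) ?_)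
  · rw [norm_neg]
    exact norm_projection_mul_mul_le hN hP.one_sub _
  · refine (norm_mul_le _ _).trans ((mul_le_of_le_one_right (norm_nonneg _)
      (hP.one_sub.norm_le _)).trans ((norm_mul_le _ _).trans ?_))
    gcongr
    exact norm_mul_one_sub_le hR hN
  · refine (norm_mul_le _ _).trans ?_
    gcongr
    · exact (norm_mul_le _ _).trans (mul_le_of_le_one_left (norm_nonneg _) (hN.norm_le _))
    · rw [norm_sub_rev]
      exact norm_mul_one_sub_le hP hR

/-- On the diagonal no gap is needed: N(N - 2P + R)P = -N(1 - R)P, and each side of the idempotent 1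
- R contributes one first difference. -/
lemma norm_secondDiff_diag_le (hR : IsStarProjection R) (hP : IsStarProjection P)
    (hN : IsStarProjection N) :
    ‖N * (N - P - (P - R)) * P‖ ≤ ‖N - R‖ * ‖P - R‖ := by
  have hP2 : P * P = P := hP.isIdempotentElem
  have hN2 : N * N = N := hN.isIdempotentElem
  have hR2 : R * R = R := hR.isIdempotentElem
  have hN3 : ∀ x, N * (N * x) = N * x := fun x => by rw [← mul_assoc, hN2]
  have hR3 : ∀ x, R * (R * x) = R * x := fun x => by rw [← mul_assoc, hR2]
  have e : N * (N - P - (P - R)) * P = -((N * (1 - R)) * ((1 - R) * (1 - (1 - P)))) := by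
    simp only [mul_sub, sub_mul, mul_one, one_mul, mul_assoc, hP2, hN3, hR3]
    abel
  rw [e, norm_neg]
  refine (norm_mul_le _ _).trans ?_
  gcongr
  · exact norm_mul_one_sub_le hR hN
  · refine (norm_mul_one_sub_le hP.one_sub hR.one_sub).trans_eq ?_
    rw [sub_sub_sub_cancel_left]

lemma GapBound.norm_secondDiff_le (h : GapBound WN N WP P κ) (hκ : 0 ≤ κ)
    (hR : IsStarProjection R) (hP : IsStarProjection P) (hN : IsStarProjection N)
    (cR : WR * R = R * WR) (cP : WP * P = P * WP) (cN : WN * N = N * WN) :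
    ‖N - P - (P - R)‖ ≤ ‖N - R‖ * ‖P - R‖ + κ * (‖WN - WP - (WP - WR)‖ + ‖N - R‖ * ‖WP - WR‖
      + ‖WN - WR‖ * ‖P - R‖) := by
  have eN : ‖(1 - N) - (1 - R)‖ = ‖N - R‖ := by rw [sub_sub_sub_cancel_left, norm_sub_rev]
  have eP : ‖(1 - P) - (1 - R)‖ = ‖P - R‖ := by rw [sub_sub_sub_cancel_left, norm_sub_rev]
  have eF : (1 - N) - (1 - P) - ((1 - P) - (1 - R)) = -(N - P - (P - R)) := by abel
  refine (norm_le_max_add_max hN hP _).trans (add_le_add (max_le ?_ ?_) (max_le ?_ ?_))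
  · exact norm_secondDiff_diag_le hR hP hN
  · have := norm_secondDiff_diag_le hR.one_sub hP.one_sub hN.one_sub
    rwa [eN, eP, eF, mul_neg, neg_mul, norm_neg] at this
  · exact norm_secondDiff_offDiag_le h.1 hκ hR hP hN cR cP cN
  · have h2 : SylvesterBound WN (1 - N) WP (1 - (1 - P)) κ := by
      rw [sub_sub_cancel]
      exact h.2
    have := norm_secondDiff_offDiag_le h2 hκ hR.one_sub hP.one_sub hN.one_sub
      (one_sub_commute cR) (one_sub_commute cP) (one_sub_commute cN)
    rwa [eN, eP, eF, mul_neg, neg_mul, norm_neg, sub_sub_cancel] at this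

end SecondDifference

/-! ### Off-diagonal solutions of the commutator equation -/

section Commutator

variable {W W' P P' X X' Y Y' : H →L[ℂ] H}

lemma mul_mul_eq_zero_of_offDiag (hP : IsStarProjection P) (hX : P * X = X * (1 - P)) :
    P * X * P = 0 ∧ (1 - P) * X * (1 - P) = 0 := by
  have hP2 : P * P = P := hP.isIdempotentElem
  constructor
  · rw [hX, mul_assoc, sub_mul, one_mul, hP2, sub_self, mul_zero]
  · rw [mul_assoc, ← hX, ← mul_assoc, sub_mul, one_mul, hP2, sub_self, zero_mul]

lemma GapBound.norm_le_of_commutator (h : GapBound W P W P κ) (hκ : 0 ≤ κ)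
    (hP : IsStarProjection P) (cP : W * P = P * W) (hW : ‖W‖ ≤ 1) (hX : P * X = X * (1 - P))
    (hXY : X * W - W * X = W * Y) : ‖X‖ ≤ κ * ‖Y‖ := by
  obtain ⟨h1, h2⟩ := mul_mul_eq_zero_of_offDiag hP hX
  have hWY : ‖W * Y‖ ≤ ‖Y‖ :=
    (norm_mul_le _ _).trans (mul_le_of_le_one_left (norm_nonneg _) hW)
  have := norm_le_max_add_max hP hP X
  rw [h1, h2, norm_zero, max_self, zero_add] at this
  refine this.trans (max_le ?_ ?_)
  · refine (h.1.norm_block_le hP hP.one_sub cP (one_sub_commute cP) X).trans ?_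
    rw [hXY]
    gcongr
    exact (norm_projection_mul_mul_le hP hP.one_sub _).trans hWY
  · refine (h.2.norm_block_le hP.one_sub hP (one_sub_commute cP) cP X).trans ?_
    rw [hXY]
    gcongr
    exact (norm_projection_mul_mul_le hP.one_sub hP _).trans hWY

/-- The diagonal blocks of the equation are trivial for off-diagonal data, and each off-diagonal
block is a Sylvester equation between the two separated parts of the spectrum. -/
lemma exists_commutator_eq (h1 : SylvesterSolvable W P W (1 - P))
    (h2 : SylvesterSolvable W (1 - P) W P) (hP : IsStarProjection P) (cP : W * P = P * W)
    (hY : P * Y = Y * (1 - P)) :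
    ∃ X, P * X = X * (1 - P) ∧ X * W - W * X = W * Y := by
  have hP2 : P * P = P := hP.isIdempotentElem
  have hP3 : ∀ x, P * (P * x) = P * x := fun x => by rw [← mul_assoc, hP2]
  have hQ2 : (1 - P) * (1 - P) = 1 - P := hP.one_sub.isIdempotentElem
  have hZ : P * (W * Y) = W * Y * (1 - P) := by
    rw [← mul_assoc, ← cP, mul_assoc, hY, mul_assoc]
  have hZ' : (1 - P) * (W * Y) = W * Y * P := by
    rw [sub_mul, hZ, one_mul, mul_sub, mul_one, sub_sub_cancel]
  obtain ⟨X₁, a1, a2, a3⟩ := h1 (P * (W * Y)) (by rw [hP3]) (by rw [hZ, mul_assoc, hQ2])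
  obtain ⟨X₂, b1, b2, b3⟩ := h2 ((1 - P) * (W * Y)) (by rw [← mul_assoc, hQ2])
    (by rw [hZ', mul_assoc, hP2])
  refine ⟨X₁ + X₂, ?_, ?_⟩
  · have a4 : P * X₂ = 0 := by
      rw [← b1, ← mul_assoc, mul_sub, mul_one, hP2, sub_self, zero_mul]
    have a5 : X₂ * (1 - P) = 0 := by rw [mul_sub, b2, mul_one, sub_self]
    rw [mul_add, add_mul, a1, a2, a4, a5]
  · calc (X₁ + X₂) * W - W * (X₁ + X₂) = (X₁ * W - W * X₁) + (X₂ * W - W * X₂) := by noncomm_ring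
      _ = W * Y := by rw [a3, b3]; noncomm_ring

lemma norm_conj_le_of_block_eq_zero (hP : IsStarProjection P) (hP' : IsStarProjection P')
    (hX : P * X * P = 0) : ‖P' * X * P'‖ ≤ 2 * ‖P' - P‖ * ‖X‖ := by
  have e : P' * X * P' = (P' - P) * X * P' + P * X * (P' - P) := by
    rw [mul_sub, hX]
    noncomm_ring
  rw [e]
  have n1 : ‖(P' - P) * X * P'‖ ≤ ‖P' - P‖ * ‖X‖ := (norm_mul_le _ _).trans
    ((mul_le_of_le_one_right (norm_nonneg _) (hP'.norm_le _)).trans (norm_mul_le _ _))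
  have n2 : ‖P * X * (P' - P)‖ ≤ ‖X‖ * ‖P' - P‖ := by
    refine (norm_mul_le _ _).trans ?_
    gcongr
    exact (norm_mul_le _ _).trans (mul_le_of_le_one_left (norm_nonneg _) (hP.norm_le _))
  linarith [norm_add_le ((P' - P) * X * P') (P * X * (P' - P))]

/-- Two off-diagonal solutions of the commutator equation, with different data. -/
lemma GapBound.norm_sub_le_of_commutator (h : GapBound W' P' W' P' κ) (hκ : 0 ≤ κ)
    (hP : IsStarProjection P) (hP' : IsStarProjection P') (cP' : W' * P' = P' * W')
    (hW' : ‖W'‖ ≤ 1) (hX : P * X = X * (1 - P)) (hX' : P' * X' = X' * (1 - P'))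
    (hXY : X * W - W * X = W * Y) (hXY' : X' * W' - W' * X' = W' * Y') :
    ‖X' - X‖ ≤ 2 * ‖P' - P‖ * ‖X‖ + κ * (‖Y' - Y‖ + ‖W' - W‖ * (‖Y‖ + 2 * ‖X‖)) := by
  obtain ⟨z1, z2⟩ := mul_mul_eq_zero_of_offDiag hP hX
  obtain ⟨z1', z2'⟩ := mul_mul_eq_zero_of_offDiag hP' hX'
  have e : (X' - X) * W' - W' * (X' - X)
      = W' * (Y' - Y) + (W' - W) * Y - X * (W' - W) + (W' - W) * X := by
    calc _ = (X' * W' - W' * X') - (X * W - W * X) - X * (W' - W) + (W' - W) * X := by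
          noncomm_ring
      _ = _ := by rw [hXY, hXY']; noncomm_ring
  have hn : ‖(X' - X) * W' - W' * (X' - X)‖ ≤ ‖Y' - Y‖ + ‖W' - W‖ * (‖Y‖ + 2 * ‖X‖) := by
    rw [e]
    have n1 : ‖W' * (Y' - Y)‖ ≤ ‖Y' - Y‖ :=
      (norm_mul_le _ _).trans (mul_le_of_le_one_left (norm_nonneg _) hW')
    have n2 := norm_mul_le (W' - W) Y
    have n3 := norm_mul_le X (W' - W)
    have n4 := norm_mul_le (W' - W) X
    have m1 := norm_add_le (W' * (Y' - Y) + (W' - W) * Y - X * (W' - W)) ((W' - W) * X)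
    have m2 := _root_.norm_sub_le (W' * (Y' - Y) + (W' - W) * Y) (X * (W' - W))
    have m3 := norm_add_le (W' * (Y' - Y)) ((W' - W) * Y)
    linarith
  -- `X` is off-diagonal for P but not for P'. The diagonal blocks of the difference thus come from
  -- `X` alone and cost ‖P' - P‖; the off-diagonal ones satisfy a Sylvester equation for `W'`.
  refine (norm_le_max_add_max hP' hP' _).trans (add_le_add (max_le ?_ ?_) (max_le ?_ ?_))
  · rw [mul_sub, sub_mul, z1', zero_sub, norm_neg]
    exact norm_conj_le_of_block_eq_zero hP hP' z1
  · rw [mul_sub (1 - P'), sub_mul _ _ (1 - P'), z2', zero_sub, norm_neg]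
    refine (norm_conj_le_of_block_eq_zero hP.one_sub hP'.one_sub z2).trans_eq ?_
    rw [sub_sub_sub_cancel_left, norm_sub_rev]
  · refine (h.1.norm_block_le hP' hP'.one_sub cP' (one_sub_commute cP') _).trans ?_
    gcongr
    exact (norm_projection_mul_mul_le hP' hP'.one_sub _).trans hn
  · refine (h.2.norm_block_le hP'.one_sub hP' (one_sub_commute cP') cP' _).trans ?_
    gcongr
    exact (norm_projection_mul_mul_le hP'.one_sub hP' _).trans hn

end Commutator

/-! ### Summation by parts -/

section Evolution

lemma norm_le_one_of_mem_unitary {u : H →L[ℂ] H} (hu : u ∈ unitary (H →L[ℂ] H)) : ‖u‖ ≤ 1 := by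
  rcases subsingleton_or_nontrivial (H →L[ℂ] H) with h | h
  · rw [Subsingleton.elim u 0, norm_zero]
    exact zero_le_one
  · exact (CStarRing.norm_of_mem_unitary hu).le

lemma norm_star_mul_mul_le {u : H →L[ℂ] H} (hu : u ∈ unitary (H →L[ℂ] H)) (X : H →L[ℂ] H) :
    ‖star u * X * u‖ ≤ ‖X‖ := by
  have h1 := norm_le_one_of_mem_unitary hu
  have h2 := norm_le_one_of_mem_unitary (Unitary.star_mem hu)
  refine (norm_mul_le _ _).trans ((mul_le_of_le_one_right (norm_nonneg _) h1).trans ?_)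
  exact (norm_mul_le _ _).trans (mul_le_of_le_one_left (norm_nonneg _) h2)

lemma norm_star_mul_mul_sub_le {V : H →L[ℂ] H} (hV : V ∈ unitary (H →L[ℂ] H))
    (X X' : H →L[ℂ] H) :
    ‖star V * X' * V - X‖ ≤ 2 * ‖V - 1‖ * ‖X‖ + ‖X' - X‖ := by
  have h1 : star V * V = 1 := (Unitary.mem_iff.mp hV).1
  have e : star V * X' * V - X
      = star V * (X * (V - 1) - (V - 1) * X) + star V * (X' - X) * V := by
    have : star V * (X * (V - 1) - (V - 1) * X) + star V * (X' - X) * V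
        = star V * X' * V - star V * V * X := by noncomm_ring
    rw [this, h1, one_mul]
  rw [e]
  refine (norm_add_le _ _).trans (add_le_add ?_ (norm_star_mul_mul_le hV _))
  refine (norm_mul_le _ _).trans ((mul_le_of_le_one_left (norm_nonneg _)
    (norm_le_one_of_mem_unitary (Unitary.star_mem hV))).trans ((norm_sub_le _ _).trans ?_))
  linarith [norm_mul_le X (V - 1), norm_mul_le (V - 1) X]

lemma evolution_mem_unitary {W : ℕ → H →L[ℂ] H} {n : ℕ}
    (hW : ∀ m < n, W m ∈ unitary (H →L[ℂ] H)) : evolution W n ∈ unitary (H →L[ℂ] H) := by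
  induction n with
  | zero => exact one_mem _
  | succ n ih => exact mul_mem (hW n n.lt_succ_self) (ih fun m hm => hW m (hm.trans n.lt_succ_self))

/-- A discrete Volterra argument: if `star (V m) = v m + Y m` and `Y m` is a commutator
`(W (m + 1))⁻¹ [X (m + 1), W (m + 1)]`, then the evolutions generated by `W` and `V W` are close. -/
theorem norm_evolution_sub_evolution_le {N : ℕ} {W V v Y X : ℕ → H →L[ℂ] H}
    (hW : ∀ m ≤ N, W m ∈ unitary (H →L[ℂ] H)) (hV : ∀ m ≤ N, V m ∈ unitary (H →L[ℂ] H))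
    (hvY : ∀ m ≤ N, star (V m) = v m + Y m)
    (hX : ∀ m < N, X (m + 1) * W (m + 1) - W (m + 1) * X (m + 1) = W (m + 1) * Y m) :
    ‖evolution W (N + 1) - evolution (fun m => V m * W m) (N + 1)‖ ≤
      ‖V N - 1‖ + ‖X (N + 1)‖ + ‖X 1‖ + ∑ m ∈ Finset.range N, (‖1 - v m‖
        + ‖X (m + 2)‖ * ‖V m - 1‖ + 2 * ‖V (m + 1) - 1‖ * ‖X (m + 1)‖
        + ‖X (m + 2) - X (m + 1)‖) := by
  set U := evolution W with hU
  set A := evolution (fun m => V m * W m) with hA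
  set Ω : ℕ → H →L[ℂ] H := fun m => star (A m) * U m with hΩ
  set B : ℕ → H →L[ℂ] H := fun m => star (A m) * X m * A m with hB
  have uA : ∀ m ≤ N + 1, A m ∈ unitary (H →L[ℂ] H) := fun m hm =>
    evolution_mem_unitary fun k hk => mul_mem (hV k (by omega)) (hW k (by omega))
  have uU : ∀ m ≤ N + 1, U m ∈ unitary (H →L[ℂ] H) := fun m hm =>
    evolution_mem_unitary fun k hk => hW k (by omega)
  have nΩ : ∀ m ≤ N + 1, ‖Ω m‖ ≤ 1 := fun m hm =>
    norm_le_one_of_mem_unitary (mul_mem (Unitary.star_mem (uA m hm)) (uU m hm))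
  have nB : ∀ m ≤ N + 1, ‖B m‖ ≤ ‖X m‖ := fun m hm => norm_star_mul_mul_le (uA m hm) _
  have hmulΩ : ∀ m ≤ N + 1, ∀ T : H →L[ℂ] H, ‖T * Ω m‖ ≤ ‖T‖ := fun m hm T =>
    (norm_mul_le _ _).trans (mul_le_of_le_one_right (norm_nonneg _) (nΩ m hm))
  have hΩstep : ∀ m ≤ N, Ω (m + 1) - Ω m =
      star (A (m + 1)) * (star (V m) - 1) * A (m + 1) * Ω m := by
    intro m hm
    have a1 : A m * star (A m) = 1 := (Unitary.mem_iff.mp (uA m (by omega))).2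
    have a2 : star (A (m + 1)) * A (m + 1) = 1 := (Unitary.mem_iff.mp (uA (m + 1) (by omega))).1
    have v1 : star (V m) * V m = 1 := (Unitary.mem_iff.mp (hV m hm)).1
    have e1 : star (V m) * A (m + 1) = W m * A m := by
      change star (V m) * (V m * W m * A m) = _
      rw [← mul_assoc, ← mul_assoc, v1, one_mul]
    have e2 : Ω (m + 1) = star (A (m + 1)) * star (V m) * A (m + 1) * Ω m := by
      rw [mul_assoc _ (star (V m)), e1]
      change star (A (m + 1)) * (W m * U m) = star (A (m + 1)) * (W m * A m) * (star (A m) * U m)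
      rw [mul_assoc (star (A (m + 1))), mul_assoc (W m), ← mul_assoc (A m), a1, one_mul]
    rw [e2, mul_sub, sub_mul, mul_one, a2, sub_mul, one_mul]
  have nΩstep : ∀ m ≤ N, ‖Ω (m + 1) - Ω m‖ ≤ ‖V m - 1‖ := by
    intro m hm
    rw [hΩstep m hm]
    refine (hmulΩ m (by omega) _).trans
      ((norm_star_mul_mul_le (uA (m + 1) (by omega)) _).trans_eq ?_)
    rw [← norm_star, star_sub, star_star, star_one]
  -- Inserting Y = W†XW - X makes A†YA the difference of B, up to the error of replacing V†X(m+2)V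
  -- by X(m+1).
  have hBstep : ∀ m < N, B (m + 2) - B (m + 1) = star (A (m + 1)) * Y m * A (m + 1)
      + star (W (m + 1) * A (m + 1)) * (star (V (m + 1)) * X (m + 2) * V (m + 1) - X (m + 1))
        * (W (m + 1) * A (m + 1)) := by
    intro m hm
    have w1 : star (W (m + 1)) * W (m + 1) = 1 := (Unitary.mem_iff.mp (hW (m + 1) (by omega))).1
    have e1 : Y m = star (W (m + 1)) * X (m + 1) * W (m + 1) - X (m + 1) := by
      rw [mul_assoc, ← sub_add_cancel (X (m + 1) * W (m + 1)) (W (m + 1) * X (m + 1)), hX m hm,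
        mul_add, ← mul_assoc, ← mul_assoc, w1, one_mul, one_mul, add_sub_cancel_right]
    have e2 : B (m + 2) = star (V (m + 1) * W (m + 1) * A (m + 1)) * X (m + 2)
        * (V (m + 1) * W (m + 1) * A (m + 1)) := rfl
    rw [e2, e1]
    simp only [hB, star_mul]
    noncomm_ring
  -- This corrected quantity (1 - B(m+1))Ω(m) has increments of second order only: the Y terms
  -- cancel.
  set Θ : ℕ → H →L[ℂ] H := fun m => Ω m - B (m + 1) * Ω m with hΘ
  have hΘstep : ∀ m < N, ‖Θ (m + 1) - Θ m‖ ≤ ‖1 - v m‖ + ‖X (m + 2)‖ * ‖V m - 1‖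
      + 2 * ‖V (m + 1) - 1‖ * ‖X (m + 1)‖ + ‖X (m + 2) - X (m + 1)‖ := by
    intro m hm
    have e : Θ (m + 1) - Θ m = star (A (m + 1)) * (v m - 1) * A (m + 1) * Ω m
        - B (m + 2) * (Ω (m + 1) - Ω m)
        - star (W (m + 1) * A (m + 1)) * (star (V (m + 1)) * X (m + 2) * V (m + 1) - X (m + 1))
          * (W (m + 1) * A (m + 1)) * Ω m := by
      have e1 : Θ (m + 1) - Θ m = (Ω (m + 1) - Ω m) - B (m + 2) * (Ω (m + 1) - Ω m)
          - (B (m + 2) - B (m + 1)) * Ω m := by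
        simp only [hΘ]
        noncomm_ring
      have e2 : Ω (m + 1) - Ω m = star (A (m + 1)) * (v m - 1) * A (m + 1) * Ω m
          + star (A (m + 1)) * Y m * A (m + 1) * Ω m := by
        rw [hΩstep m hm.le, hvY m hm.le]
        noncomm_ring
      rw [e1, hBstep m hm, add_mul]
      nth_rewrite 1 [e2]
      abel
    rw [e]
    have n1 : ‖star (A (m + 1)) * (v m - 1) * A (m + 1) * Ω m‖ ≤ ‖1 - v m‖ := by
      rw [norm_sub_rev 1]
      exact (hmulΩ m (by omega) _).trans (norm_star_mul_mul_le (uA (m + 1) (by omega)) _)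
    have n2 : ‖B (m + 2) * (Ω (m + 1) - Ω m)‖ ≤ ‖X (m + 2)‖ * ‖V m - 1‖ :=
      (norm_mul_le _ _).trans (mul_le_mul (nB _ (by omega)) (nΩstep m hm.le) (norm_nonneg _)
        (norm_nonneg _))
    have n3 := (hmulΩ m (by omega) _).trans ((norm_star_mul_mul_le
      (mul_mem (hW (m + 1) (by omega)) (uA (m + 1) (by omega)))
      (star (V (m + 1)) * X (m + 2) * V (m + 1) - X (m + 1))).trans
      (norm_star_mul_mul_sub_le (hV (m + 1) (by omega)) _ _))
    linarith [norm_sub_le_of_le (norm_sub_le_of_le n1 n2) n3]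
  have hΩ0 : Ω 0 = 1 := by
    change star (1 : H →L[ℂ] H) * 1 = 1
    rw [star_one, one_mul]
  have hfin : U (N + 1) - A (N + 1) = A (N + 1) * (Ω (N + 1) - 1) := by
    have : A (N + 1) * star (A (N + 1)) = 1 := (Unitary.mem_iff.mp (uA (N + 1) le_rfl)).2
    rw [mul_sub, mul_one, hΩ, ← mul_assoc, this, one_mul]
  -- The last step of Ω is kept outside the sum, since summing it by parts would require X(N+2),
  -- hence a walk operator possibly beyond the final time.
  have hdec : Ω (N + 1) - 1 = (Ω (N + 1) - Ω N) + B (N + 1) * Ω N - B 1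
      + ∑ m ∈ Finset.range N, (Θ (m + 1) - Θ m) := by
    rw [Finset.sum_range_sub]
    simp only [hΘ, hΩ0, mul_one, zero_add]
    abel
  have hsum := (norm_sum_le (Finset.range N) fun m => Θ (m + 1) - Θ m).trans
    (Finset.sum_le_sum fun m hm => hΘstep m (Finset.mem_range.mp hm))
  have n1 := nΩstep N le_rfl
  have n2 := (hmulΩ N (by omega) (B (N + 1))).trans (nB (N + 1) le_rfl)
  have n3 := nB 1 (by omega)
  rw [hfin]
  refine (norm_mul_le _ _).trans ((mul_le_of_le_one_left (norm_nonneg _)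
    (norm_le_one_of_mem_unitary (uA (N + 1) le_rfl))).trans ?_)
  rw [hdec]
  exact norm_add_le_of_le (norm_sub_le_of_le (norm_add_le_of_le n1 n2) n3) hsum

end Evolution

/-! ### Multistep gaps -/

section Gap

/-- The norm of the solution operator of the Sylvester equation with gap `δ`. -/
def gapConst (δ : ℝ) : ℝ := (2 * Real.sin (δ / 2))⁻¹

variable {δ : ℝ}

lemma sin_half_pos (h0 : 0 < δ) (hpi : δ ≤ Real.pi) : 0 < Real.sin (δ / 2) :=
  Real.sin_pos_of_pos_of_lt_pi (by linarith) (by linarith)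

lemma half_le_gapConst (h0 : 0 < δ) (hpi : δ ≤ Real.pi) : 1 / 2 ≤ gapConst δ := by
  rw [gapConst, one_div]
  have := sin_half_pos h0 hpi
  exact inv_anti₀ (by positivity) (by linarith [Real.sin_le_one (δ / 2)])

lemma gapConst_pos (h0 : 0 < δ) (hpi : δ ≤ Real.pi) : 0 < gapConst δ :=
  one_half_pos.trans_le (half_le_gapConst h0 hpi)

/-- Jordan's inequality, sin t ≥ 2t/π on [0, π/2]. -/
lemma gapConst_le (h0 : 0 < δ) (hpi : δ ≤ Real.pi) : gapConst δ ≤ Real.pi / (2 * δ) := by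
  have h := Real.mul_le_sin (x := δ / 2) (by linarith) (by linarith)
  have hp := Real.pi_pos
  rw [gapConst, ← one_div, one_div_le (by linarith [sin_half_pos h0 hpi]) (by positivity),
    one_div_div]
  refine le_of_eq_of_le ?_ (mul_le_mul_of_nonneg_left h zero_le_two)
  field_simp

lemma gapConst_le_two_div (h0 : 0 < δ) (hpi : δ ≤ Real.pi) : gapConst δ ≤ 2 / δ := by
  refine (gapConst_le h0 hpi).trans ?_
  rw [div_le_div_iff₀ (by linarith) h0]
  nlinarith [Real.pi_le_four]

lemma one_sub_cos_half_pos (h0 : 0 < δ) (hpi : δ ≤ Real.pi) : 0 < 1 - Real.cos (δ / 2) := by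
  have h1 := sin_half_pos h0 hpi
  nlinarith [Real.sin_sq_add_cos_sq (δ / 2), Real.cos_le_one (δ / 2)]

/-- sin² = (1 - cos)(1 + cos) ≥ 1 - cos at δ/2, the cosine being nonnegative for δ ≤ π. -/
lemma gapConst_sq_le (h0 : 0 < δ) (hpi : δ ≤ Real.pi) :
    gapConst δ ^ 2 ≤ 1 / (4 * (1 - Real.cos (δ / 2))) := by
  have h1 := sin_half_pos h0 hpi
  have h2 := one_sub_cos_half_pos h0 hpi
  have h3 : 0 ≤ Real.cos (δ / 2) := Real.cos_nonneg_of_mem_Icc ⟨by linarith, by linarith⟩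
  rw [gapConst, inv_pow, ← one_div]
  refine one_div_le_one_div_of_le (by positivity) ?_
  nlinarith [Real.sin_sq_add_cos_sq (δ / 2)]

variable {σP σQ : ℕ → Set ℂ} {k n : ℕ} {W : ℕ → H →L[ℂ] H}

lemma IsMultistepGap.pos (h : IsMultistepGap σP σQ k n δ) : 0 < δ := by
  obtain ⟨A, B, hA, hB, hAB, -, -, rfl⟩ := h
  exact angularDist_pos hA hB hAB

lemma IsMultistepGap.le_pi (h : IsMultistepGap σP σQ k n δ) : δ ≤ Real.pi := by
  obtain ⟨A, B, hA, hB, hAB, -, -, rfl⟩ := h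
  exact angularDist_le_pi hA hB

lemma IsMultistepGap.symm (h : IsMultistepGap σP σQ k n δ) : IsMultistepGap σQ σP k n δ := by
  obtain ⟨A, B, hA, hB, hAB, h1, h2, h3⟩ := h
  exact ⟨B, A, hB, hA, hAB.symm, h2, h1, h3.trans (angularDist_comm A B)⟩

/-- The spectral parts are not assumed closed; each is the intersection of the compact spectrum with
one of the closed arcs. -/
lemma IsMultistepGap.spectralSplit (h : IsMultistepGap σP σQ k n δ) {i : ℕ} (hi : i ≤ k)
    (hW : IsStarNormal (W (n + i))) (hσ : spectrum ℂ (W (n + i)) = σP (n + i) ∪ σQ (n + i)) :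
    SpectralSplit (W (n + i)) (σP (n + i)) (σQ (n + i)) := by
  obtain ⟨A, B, hA, hB, hAB, h1, h2, -⟩ := h
  have a1 : σP (n + i) ⊆ A := fun _ hz => h1 (Set.mem_biUnion (Set.mem_Iic.mpr hi) hz)
  have a2 : σQ (n + i) ⊆ B := fun _ hz => h2 (Set.mem_biUnion (Set.mem_Iic.mpr hi) hz)
  have hcl := spectrum.isClosed (𝕜 := ℂ) (W (n + i))
  rw [hσ] at hcl
  have e1 : σP (n + i) = (σP (n + i) ∪ σQ (n + i)) ∩ A := by
    rw [Set.union_inter_distrib_right, Set.inter_eq_left.mpr a1,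
      (hAB.symm.mono_left a2).inter_eq, Set.union_empty]
  have e2 : σQ (n + i) = (σP (n + i) ∪ σQ (n + i)) ∩ B := by
    rw [Set.union_inter_distrib_right, Set.inter_eq_left.mpr a2,
      (hAB.mono_left a1).inter_eq, Set.empty_union]
  exact ⟨hW, hσ, e1 ▸ hcl.inter hA.isCompact.isClosed, e2 ▸ hcl.inter hB.isCompact.isClosed,
    hAB.mono a1 a2⟩

lemma IsMultistepGap.sylvester (h : IsMultistepGap σP σQ k n δ) {i j : ℕ} (hi : i ≤ k)
    (hj : j ≤ k) (si : SpectralSplit (W (n + i)) (σP (n + i)) (σQ (n + i)))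
    (sj : SpectralSplit (W (n + j)) (σP (n + j)) (σQ (n + j))) :
    SylvesterBound (W (n + i)) (specProj (W (n + i)) (σP (n + i))) (W (n + j))
        (1 - specProj (W (n + j)) (σP (n + j))) (gapConst δ) ∧
      SylvesterSolvable (W (n + i)) (specProj (W (n + i)) (σP (n + i))) (W (n + j))
        (1 - specProj (W (n + j)) (σP (n + j))) := by
  obtain ⟨A, B, hA, hB, hAB, h1, h2, rfl⟩ := h
  have a1 : σP (n + i) ⊆ A := fun _ hz => h1 (Set.mem_biUnion (Set.mem_Iic.mpr hi) hz)
  have a2 : σQ (n + j) ⊆ B := fun _ hz => h2 (Set.mem_biUnion (Set.mem_Iic.mpr hj) hz)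
  rw [sj.one_sub]
  exact si.sylvester_of_arcs sj.symm hA hB hAB a1 a2

lemma IsMultistepGap.gapBound (h : IsMultistepGap σP σQ k n δ) {i j : ℕ} (hi : i ≤ k)
    (hj : j ≤ k) (si : SpectralSplit (W (n + i)) (σP (n + i)) (σQ (n + i)))
    (sj : SpectralSplit (W (n + j)) (σP (n + j)) (σQ (n + j))) :
    GapBound (W (n + i)) (specProj (W (n + i)) (σP (n + i))) (W (n + j))
      (specProj (W (n + j)) (σP (n + j))) (gapConst δ) := by
  refine ⟨(h.sylvester hi hj si sj).1, ?_⟩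
  have := (h.symm.sylvester hi hj si.symm sj.symm).1
  rwa [sj.symm.one_sub, ← si.one_sub] at this

lemma IsMultistepGap.exists_commutator_eq (h : IsMultistepGap σP σQ k n δ)
    (s : SpectralSplit (W n) (σP n) (σQ n)) {Y : H →L[ℂ] H}
    (hY : specProj (W n) (σP n) * Y = Y * (1 - specProj (W n) (σP n))) :
    ∃ X, specProj (W n) (σP n) * X = X * (1 - specProj (W n) (σP n)) ∧
      X * W n - W n * X = W n * Y := by
  have h1 := (h.sylvester (W := W) (i := 0) (j := 0) (Nat.zero_le _) (Nat.zero_le _) s s).2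
  have h2 := (h.symm.sylvester (W := W) (i := 0) (j := 0) (Nat.zero_le _) (Nat.zero_le _) s.symm
    s.symm).2
  simp only [add_zero] at h1 h2
  rw [s.symm.one_sub, ← s.one_sub] at h2
  exact DiscreteAdiabatic.exists_commutator_eq h1 h2 s.isStarProjection s.commute hY

end Gap

/-! ### Scalar estimates -/

section Scalars

lemma sum_Icc_one_eq_sum_range (N : ℕ) (f : ℕ → ℝ) :
    ∑ m ∈ Finset.Icc 1 N, f m = ∑ m ∈ Finset.range N, f (m + 1) := by
  rw [Finset.range_eq_Ico, Finset.sum_Ico_add' f 0 N 1, zero_add, Finset.Ico_add_one_right_eq_Icc]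

/-- The factor 8/π is chosen so that multiplication by `gapConst` ≤ π/(2Δ₁) later gives exactly the
4/Δ₁ of the final bound. The room needed is 3π² ≤ 32. -/
lemma gapConst_secondDiff_le {c₀ c₁ c₂ δ : ℝ} (h0 : 0 < δ) (hpi : δ ≤ Real.pi) (hc₀ : 0 ≤ c₀)
    (hc₁ : 0 ≤ c₁) (hc₂ : 0 ≤ c₂) :
    gapConst δ * c₂ + 3 * gapConst δ ^ 2 * (c₀ ^ 2 + c₀ * c₁) ≤
      8 / Real.pi * ((c₀ ^ 2 + c₀ * c₁) / (Real.pi * (1 - Real.cos (δ / 2))) + 2 * c₂ / δ) := by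
  have hp := Real.pi_pos
  have hp' : Real.pi ^ 2 ≤ 10 := by nlinarith [Real.pi_lt_d2]
  have hcos := one_sub_cos_half_pos h0 hpi
  have h1 : gapConst δ * c₂ ≤ 8 / Real.pi * (2 * c₂ / δ) := by
    calc gapConst δ * c₂ ≤ Real.pi / (2 * δ) * c₂ := by
          gcongr
          exact gapConst_le h0 hpi
      _ = Real.pi ^ 2 / (2 * Real.pi * δ) * c₂ := by field_simp
      _ ≤ 32 / (2 * Real.pi * δ) * c₂ := by
          gcongr
          linarith
      _ = _ := by field_simp; ring
  have h2 : 3 * gapConst δ ^ 2 * (c₀ ^ 2 + c₀ * c₁) ≤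
      8 / Real.pi * ((c₀ ^ 2 + c₀ * c₁) / (Real.pi * (1 - Real.cos (δ / 2)))) := by
    have hc : 0 ≤ c₀ ^ 2 + c₀ * c₁ := by positivity
    calc 3 * gapConst δ ^ 2 * (c₀ ^ 2 + c₀ * c₁)
        ≤ 3 * (1 / (4 * (1 - Real.cos (δ / 2)))) * (c₀ ^ 2 + c₀ * c₁) := by
          gcongr
          exact gapConst_sq_le h0 hpi
      _ = 3 * Real.pi ^ 2 / (4 * Real.pi ^ 2 * (1 - Real.cos (δ / 2))) * (c₀ ^ 2 + c₀ * c₁) := by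
          field_simp
      _ ≤ 32 / (4 * Real.pi ^ 2 * (1 - Real.cos (δ / 2))) * (c₀ ^ 2 + c₀ * c₁) := by
          gcongr
          linarith
      _ = _ := by field_simp; ring
  linarith

/-- As `gapConst` is at least 1/2, the linear term is at most twice the square, and 4 `gapConst`² ≤
1/(1 - cos(δ/2)). -/
lemma gapConst_add_sq_le {δ : ℝ} (h0 : 0 < δ) (hpi : δ ≤ Real.pi) :
    gapConst δ + 2 * gapConst δ ^ 2 ≤ 4 / (Real.pi * (1 - Real.cos (δ / 2))) := by
  have hcos := one_sub_cos_half_pos h0 hpi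
  have h1 := half_le_gapConst h0 hpi
  have h2 := gapConst_sq_le h0 hpi
  have h3 : 4 * (1 / (4 * (1 - Real.cos (δ / 2)))) ≤ 4 / (Real.pi * (1 - Real.cos (δ / 2))) := by
    rw [mul_one_div]
    have := Real.pi_pos
    gcongr
    exact Real.pi_le_four
  nlinarith

variable {T : ℕ} {c Δ : ℕ → ℕ → ℝ} {m : ℕ}

lemma G₁_nonneg (hc : 0 ≤ c 1 m) (hc' : 0 ≤ c 1 (m + 1)) (hc₂ : 0 ≤ c 2 m) (h0 : 0 < Δ 2 m)
    (hpi : Δ 2 m ≤ Real.pi) : 0 ≤ G₁ c Δ m := by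
  have := one_sub_cos_half_pos h0 hpi
  have := Real.pi_pos
  rw [G₁]
  positivity

lemma D₃_nonneg {z : ℝ} (hz0 : 0 ≤ z) (hz1 : z < 1) : 0 ≤ D₃ z := by
  have := D₁_one_le hz0 hz1
  rw [D₃_eq hz0 hz1]
  positivity

lemma le_G₃ (hG : 0 ≤ G₁ c Δ m) (hz : 0 ≤ 2 * c 1 m / (T * Δ 1 m))
    (hz1 : 2 * c 1 m / (T * Δ 1 m) < 1)
    (hz' : 2 * c 1 (m + 1) / (T * Δ 1 (m + 1)) < 1) :
    (D₃ (max (2 * c 1 (m + 1) / (T * Δ 1 (m + 1))) (2 * c 1 m / (T * Δ 1 m)))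
      + D₁ (2 * c 1 m / (T * Δ 1 m))) * G₁ c Δ m ≤ G₃ T c Δ m := by
  have h3 := D₃_nonneg (hz.trans (le_max_right (2 * c 1 (m + 1) / (T * Δ 1 (m + 1))) _))
    (max_lt hz' hz1)
  have h1 := D₁_one_le hz hz1
  rw [G₃, G₂]
  have e1 := mul_nonneg (mul_nonneg hG h3) hz
  have e2 : 0 ≤ D₁ (2 * c 1 m / (T * Δ 1 m)) * (8 * c 1 m ^ 2 / Δ 1 m ^ 2) := by positivity
  nlinarith

end Scalars

end DiscreteAdiabatic

end

/-! ### Assembly of the estimates into the adiabatic theorem -/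

open DiscreteAdiabatic in
theorem theorem15 {H : Type*} [NormedAddCommGroup H] [InnerProductSpace ℂ H] [CompleteSpace H]
    (T : ℕ)
    -- the walk operators `W m = W_T(m/T)`, `0 ≤ m ≤ T`
    (W : ℕ → H →L[ℂ] H) (hW : ∀ m ≤ T, W m ∈ unitary (H →L[ℂ] H))
    -- the spectrum of interest and the complementary spectrum
    (σP σQ : ℕ → Set ℂ) (hσ : ∀ m ≤ T, spectrum ℂ (W m) = σP m ∪ σQ m)
    -- the multistep differences, `c k m = c_k(m/T)`
    (c : ℕ → ℕ → ℝ)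
    (hc : ∀ k ∈ Set.Icc 1 2, ∀ m, m + k ≤ T → ‖(fwdDiff 1)^[k] W m‖ ≤ c k m / (T : ℝ) ^ k)
    -- the multistep gaps, `Δ k m = Δ_k(m/T)`
    (Δ : ℕ → ℕ → ℝ)
    (hΔ : ∀ k ≤ 2, ∀ m, m + k ≤ T → IsMultistepGap σP σQ k m (Δ k m))
    (hT : ∀ m < T, 2 * c 1 m / Δ 1 m ≤ T)
    -- the time `s = n/T`; no denominator of the bound vanishes
    (n : ℕ) (hn : 1 ≤ n) (hnT : n ≤ T) (hne : ∀ m < n, 2 * c 1 m / Δ 1 m ≠ T) :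
    ‖evolution W n - adiabaticEvolution W σP n‖ ≤
      4 / Δ 0 1 * D₂ (2 * c 1 0 / (T * Δ 1 0))
      + 4 / Δ 0 n * D₂ (2 * c 1 (n - 1) / (T * Δ 1 (n - 1)))
      + 2 * D₂ (2 * c 1 (n - 1) / (T * Δ 1 (n - 1)))
      + ∑ m ∈ Finset.Icc 1 (n - 1), 4 * (1 / Δ 0 (m + 1) + 2 / Δ 0 m)
          * D₂ (2 * c 1 m / (T * Δ 1 m)) * D₂ (2 * c 1 (m - 1) / (T * Δ 1 (m - 1)))
      + ∑ m ∈ Finset.Icc 1 (n - 1), 4 * G₃ T c Δ (m - 1) / (T ^ 2 * Δ 1 m)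
      + ∑ m ∈ Finset.Icc 1 (n - 1), 4 * c 1 m / (Real.pi * T * (1 - Real.cos (Δ 1 m / 2)))
          * D₂ (2 * c 1 (m - 1) / (T * Δ 1 (m - 1)))
      + ∑ m ∈ Finset.Icc 1 (n - 1), 4 * G₄ T c Δ (m - 1) / (T * Δ 0 m)
          * D₂ (2 * c 1 (m - 1) / (T * Δ 1 (m - 1)))
      + ∑ m ∈ Finset.range n, 24 * c 1 m ^ 2 / (T ^ 2 * Δ 1 m ^ 2)
      + ∑ m ∈ Finset.range n, 4 * c 1 m ^ 2 / (T ^ 2 * Δ 1 m ^ 2)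
          * (1 - 2 * c 1 m / (T * Δ 1 m))⁻¹ := by
  obtain ⟨N, rfl⟩ : ∃ N, n = N + 1 := ⟨n - 1, by omega⟩
  have hT0 : (0 : ℝ) < T := by exact_mod_cast (show 0 < T by omega)
  have hpi := Real.pi_pos
  -- scalar data
  have d1 : ∀ m, m + 1 ≤ T → ‖W (m + 1) - W m‖ ≤ c 1 m / T := fun m hm => by
    simpa [fwdDiff] using hc 1 (by simp) m hm
  have d2 : ∀ m, m + 2 ≤ T → ‖W (m + 2) - W (m + 1) - (W (m + 1) - W m)‖ ≤ c 2 m / (T : ℝ) ^ 2 :=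
    fun m hm => by simpa [fwdDiff] using hc 2 (by simp) m hm
  have c1 : ∀ m, m + 1 ≤ T → 0 ≤ c 1 m := fun m hm => by
    simpa [le_div_iff₀ hT0] using (norm_nonneg _).trans (d1 m hm)
  have c2 : ∀ m, m + 2 ≤ T → 0 ≤ c 2 m := fun m hm =>
    by simpa [le_div_iff₀ (pow_pos hT0 2)] using (norm_nonneg _).trans (d2 m hm)
  have pos : ∀ k ≤ 2, ∀ m, m + k ≤ T → 0 < Δ k m := fun k hk m hm => (hΔ k hk m hm).pos
  have lepi : ∀ k ≤ 2, ∀ m, m + k ≤ T → Δ k m ≤ Real.pi := fun k hk m hm => (hΔ k hk m hm).le_pi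
  set z : ℕ → ℝ := fun m => 2 * c 1 m / (T * Δ 1 m) with hz
  have z0 : ∀ m ≤ N, 0 ≤ z m := fun m hm => by
    have := c1 m (by omega)
    have := pos 1 (by omega) m (by omega)
    simp only [hz]
    positivity
  have z1 : ∀ m ≤ N, z m < 1 := fun m hm => by
    have h := lt_of_le_of_ne (hT m (by omega)) (hne m (by omega))
    have := pos 1 (by omega) m (by omega)
    rw [div_lt_iff₀ this] at h
    simp only [hz]
    rw [div_lt_one (by positivity)]
    exact h
  have zD : ∀ m ≤ N, z m ≤ D₂ (z m) := fun m hm => le_D₂ (z0 m hm) (z1 m hm)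
  -- spectral data
  set p : ℕ → H →L[ℂ] H := fun m => specProj (W m) (σP m) with hp
  have split : ∀ m ≤ T, SpectralSplit (W m) (σP m) (σQ m) := fun m hm =>
    (hΔ 0 (by omega) m hm).spectralSplit (i := 0) le_rfl
      (isStarNormal_of_mem_unitary (hW m hm)) (hσ m hm)
  have pp : ∀ m ≤ T, IsStarProjection (p m) := fun m hm => (split m hm).isStarProjection
  have cp : ∀ m ≤ T, W m * p m = p m * W m := fun m hm => (split m hm).commute
  have nW : ∀ m ≤ T, ‖W m‖ ≤ 1 := fun m hm => norm_le_one_of_mem_unitary (hW m hm)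
  have gap : ∀ k ≤ 2, ∀ m, m + k ≤ T → ∀ i ≤ k, ∀ j ≤ k,
      GapBound (W (m + i)) (p (m + i)) (W (m + j)) (p (m + j)) (gapConst (Δ k m)) :=
    fun k hk m hm i hi j hj =>
      (hΔ k hk m hm).gapBound hi hj (split _ (by omega)) (split _ (by omega))
  have κ0 : ∀ k ≤ 2, ∀ m, m + k ≤ T → 0 ≤ gapConst (Δ k m) := fun k hk m hm =>
    (gapConst_pos (pos k hk m hm) (lepi k hk m hm)).le
  -- The ratio z(m) bounds one step of the projection; being below 1, it makes v invertible and V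
  -- unitary.
  have np : ∀ m ≤ N, ‖p (m + 1) - p m‖ ≤ z m := fun m hm => by
    have hk := κ0 1 (by omega) m (by omega)
    refine ((gap 1 (by omega) m (by omega) 1 le_rfl 0 (by omega)).norm_sub_le hk (pp _ (by omega))
      (pp _ (by omega)) (cp _ (by omega)) (cp _ (by omega))).trans ?_
    have hd := pos 1 (by omega) m (by omega)
    rw [norm_sub_rev]
    calc _ ≤ 2 / Δ 1 m * (c 1 m / T) := by
          gcongr
          · exact gapConst_le_two_div hd (lepi 1 (by omega) m (by omega))
          · exact d1 m (by omega)
      _ = z m := by simp only [hz]; field_simp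
  set V : ℕ → H →L[ℂ] H := fun m => opV (p (m + 1)) (p m) with hV
  set Y : ℕ → H →L[ℂ] H := fun m => opY (p (m + 1)) (p m) with hY
  set v : ℕ → H →L[ℂ] H := fun m => opv (p (m + 1)) (p m) with hv
  have uV : ∀ m ≤ N, V m ∈ unitary (H →L[ℂ] H) := fun m hm =>
    opV_mem_unitary (pp _ (by omega)) (pp _ (by omega)) (np m hm) (z1 m hm)
  have nV : ∀ m ≤ N, ‖V m - 1‖ ≤ D₂ (z m) := fun m hm =>
    norm_opV_sub_one_le (pp _ (by omega)) (pp _ (by omega)) (np m hm) (z1 m hm)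
  have nY : ∀ m ≤ N, ‖Y m‖ ≤ D₂ (z m) := fun m hm =>
    (norm_opY (pp _ (by omega)) (pp _ (by omega)) (np m hm) (z1 m hm)).trans_le
      ((np m hm).trans (zD m hm))
  have nv : ∀ m ≤ N, ‖1 - v m‖ ≤ z m ^ 2 := fun m hm => by
    refine (norm_one_sub_opv_le (pp _ (by omega)) (pp _ (by omega)) (np m hm) (z1 m hm)).trans ?_
    have h1 := one_sub_sq_pos (z0 m hm) (z1 m hm)
    have h2 : 1 - z m ^ 2 ≤ √(1 - z m ^ 2) := Real.le_sqrt_of_sq_le (by nlinarith [sq_nonneg (z m)])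
    linarith
  have hYoff : ∀ m ≤ N, p (m + 1) * Y m = Y m * (1 - p (m + 1)) := fun m hm =>
    mul_opY_right (pp _ (by omega)) (pp _ (by omega))
  have hex : ∀ m, ∃ X : H →L[ℂ] H, m ≤ N → p (m + 1) * X = X * (1 - p (m + 1)) ∧
      X * W (m + 1) - W (m + 1) * X = W (m + 1) * Y m := fun m => by
    by_cases hm : m ≤ N
    · obtain ⟨X, hX⟩ := (hΔ 0 (by omega) (m + 1) (by omega)).exists_commutator_eq
        (split (m + 1) (by omega)) (hYoff m hm)
      exact ⟨X, fun _ => hX⟩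
    · exact ⟨0, fun h => absurd h hm⟩
  choose X₀ hX₀ using hex
  -- Index shift: the solution with data Y(m) belongs to W(m+1) and is called X(m+1). The value at 0
  -- is never used.
  set X : ℕ → H →L[ℂ] H := fun m => X₀ (m - 1) with hXdef
  have hXoff : ∀ m ≤ N, p (m + 1) * X (m + 1) = X (m + 1) * (1 - p (m + 1)) :=
    fun m hm => (hX₀ m hm).1
  have hXcomm : ∀ m ≤ N, X (m + 1) * W (m + 1) - W (m + 1) * X (m + 1) = W (m + 1) * Y m :=
    fun m hm => (hX₀ m hm).2
  have nX0 : ∀ m ≤ N, ‖X (m + 1)‖ ≤ 2 / Δ 0 (m + 1) * D₂ (z m) := fun m hm => by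
    have hd := pos 0 (by omega) (m + 1) (by omega)
    refine ((gap 0 (by omega) (m + 1) (by omega) 0 le_rfl 0 le_rfl).norm_le_of_commutator
      (κ0 0 (by omega) _ (by omega)) (pp _ (by omega)) (cp _ (by omega)) (nW _ (by omega))
      (hXoff m hm) (hXcomm m hm)).trans ?_
    gcongr
    · exact gapConst_le_two_div hd (lepi 0 (by omega) _ (by omega))
    · exact nY m hm
  -- A second bound for the same operator, with the two-step gap, so that the commutator error below
  -- involves only Δ₁.
  have nX1 : ∀ m < N, ‖X (m + 1)‖ ≤ gapConst (Δ 1 (m + 1)) * D₂ (z m) := fun m hm => by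
    have hk := κ0 1 (by omega) (m + 1) (by omega)
    refine ((gap 1 (by omega) (m + 1) (by omega) 0 (by omega) 0 (by omega)).norm_le_of_commutator
      hk (pp _ (by omega)) (cp _ (by omega)) (nW _ (by omega))
      (hXoff m hm.le) (hXcomm m hm.le)).trans ?_
    gcongr
    exact nY m hm.le
  have hG₁ : ∀ m < N, 0 ≤ G₁ c Δ m := fun m hm =>
    G₁_nonneg (c1 m (by omega)) (c1 _ (by omega)) (c2 m (by omega)) (pos 2 le_rfl m (by omega))
      (lepi 2 le_rfl m (by omega))
  have hG₃ : ∀ m < N, (D₃ (max (z (m + 1)) (z m)) + D₁ (z m)) * G₁ c Δ m ≤ G₃ T c Δ m :=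
    fun m hm => le_G₃ (hG₁ m hm) (z0 m hm.le) (z1 m hm.le) (z1 (m + 1) hm)
  have hD : ∀ m < N, 0 ≤ D₃ (max (z (m + 1)) (z m)) + D₁ (z m) := fun m hm =>
    add_nonneg (D₃_nonneg ((z0 m hm.le).trans (le_max_right _ _)) (max_lt (z1 _ hm) (z1 m hm.le)))
      (zero_le_one.trans (D₁_one_le (z0 m hm.le) (z1 m hm.le)))
  -- second differences of the spectral projections
  have nF : ∀ m < N, ‖p (m + 2) - p (m + 1) - (p (m + 1) - p m)‖
      ≤ 8 / Real.pi * G₁ c Δ m / (T : ℝ) ^ 2 := fun m hm => by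
    have hk := κ0 2 le_rfl m (by omega)
    have hc0 := c1 m (by omega)
    have hc1 := c1 (m + 1) (by omega)
    have e02 : ‖W (m + 2) - W m‖ ≤ (c 1 m + c 1 (m + 1)) / T := by
      have := norm_add_le (W (m + 2) - W (m + 1)) (W (m + 1) - W m)
      rw [sub_add_sub_cancel] at this
      rw [add_div]
      linarith [d1 m (by omega), d1 (m + 1) (by omega)]
    have a02 : ‖p (m + 2) - p m‖ ≤ gapConst (Δ 2 m) * ((c 1 m + c 1 (m + 1)) / T) := by
      refine ((gap 2 le_rfl m (by omega) 2 le_rfl 0 (by omega)).norm_sub_le hk (pp _ (by omega))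
        (pp _ (by omega)) (cp _ (by omega)) (cp _ (by omega))).trans ?_
      rw [norm_sub_rev]
      gcongr
      exact e02
    have a01 : ‖p (m + 1) - p m‖ ≤ gapConst (Δ 2 m) * (c 1 m / T) := by
      refine ((gap 2 le_rfl m (by omega) 1 (by omega) 0 (by omega)).norm_sub_le hk (pp _ (by omega))
        (pp _ (by omega)) (cp _ (by omega)) (cp _ (by omega))).trans ?_
      rw [norm_sub_rev]
      gcongr
      exact d1 m (by omega)
    have h := (gap 2 le_rfl m (by omega) 2 le_rfl 1 (by omega)).norm_secondDiff_le hk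
      (pp m (by omega)) (pp (m + 1) (by omega)) (pp (m + 2) (by omega)) (cp m (by omega))
      (cp (m + 1) (by omega)) (cp (m + 2) (by omega))
    refine h.trans ?_
    calc _ ≤ gapConst (Δ 2 m) * ((c 1 m + c 1 (m + 1)) / T) * (gapConst (Δ 2 m) * (c 1 m / T))
          + gapConst (Δ 2 m) * (c 2 m / (T : ℝ) ^ 2
            + gapConst (Δ 2 m) * ((c 1 m + c 1 (m + 1)) / T) * (c 1 m / T)
            + (c 1 m + c 1 (m + 1)) / T * (gapConst (Δ 2 m) * (c 1 m / T))) := by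
          gcongr
          · exact d2 m (by omega)
          · exact d1 m (by omega)
      _ = (gapConst (Δ 2 m) * c 2 m + 3 * gapConst (Δ 2 m) ^ 2 *
            (c 1 m ^ 2 + c 1 m * c 1 (m + 1))) / (T : ℝ) ^ 2 := by
          field_simp
          ring
      _ ≤ _ := by
          gcongr
          exact gapConst_secondDiff_le (pos 2 le_rfl m (by omega)) (lepi 2 le_rfl m (by omega))
            hc0 hc1 (c2 m (by omega))
  have nYdiff : ∀ m < N, gapConst (Δ 1 (m + 1)) * ‖Y (m + 1) - Y m‖
      ≤ 4 * G₃ T c Δ m / ((T : ℝ) ^ 2 * Δ 1 (m + 1)) := fun m hm => by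
    have hd := pos 1 (by omega) (m + 1) (by omega)
    have hk := κ0 1 (by omega) (m + 1) (by omega)
    have h := norm_opY_sub_opY_le (z₀ := z m) (z := max (z (m + 1)) (z m)) (pp m (by omega))
      (pp (m + 1) (by omega)) (pp (m + 2) (by omega)) (np m hm.le)
      ((np (m + 1) hm).trans (le_max_left _ _)) (le_max_right _ _) (max_lt (z1 _ hm) (z1 m hm.le))
    have hD' := hD m hm
    -- The factors π/2 and 8/π multiply to 4.
    calc gapConst (Δ 1 (m + 1)) * ‖Y (m + 1) - Y m‖
        ≤ Real.pi / (2 * Δ 1 (m + 1)) * ((D₃ (max (z (m + 1)) (z m)) + D₁ (z m)) *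
          (8 / Real.pi * G₁ c Δ m / (T : ℝ) ^ 2)) := by
          gcongr
          · exact gapConst_le hd (lepi 1 (by omega) _ (by omega))
          · exact h.trans (by gcongr; exact nF m hm)
      _ = 4 * ((D₃ (max (z (m + 1)) (z m)) + D₁ (z m)) * G₁ c Δ m)
          / ((T : ℝ) ^ 2 * Δ 1 (m + 1)) := by
          field_simp
          ring
      _ ≤ _ := by
          gcongr
          exact hG₃ m hm
  have nXdiff : ∀ m < N, ‖X (m + 2) - X (m + 1)‖ ≤
      2 * D₂ (z (m + 1)) * (2 / Δ 0 (m + 1) * D₂ (z m))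
      + (4 * G₃ T c Δ m / ((T : ℝ) ^ 2 * Δ 1 (m + 1))
        + 4 * c 1 (m + 1) / (Real.pi * T * (1 - Real.cos (Δ 1 (m + 1) / 2))) * D₂ (z m)) :=
    fun m hm => by
    have hd := pos 1 (by omega) (m + 1) (by omega)
    have hdpi := lepi 1 (by omega) (m + 1) (by omega)
    have hk := κ0 1 (by omega) (m + 1) (by omega)
    have hc1 := c1 (m + 1) (by omega)
    have hD0 : 0 ≤ D₂ (z m) := (z0 m hm.le).trans (zD m hm.le)
    have hD1 : 0 ≤ D₂ (z (m + 1)) := (z0 _ hm).trans (zD _ hm)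
    refine ((gap 1 (by omega) (m + 1) (by omega) 1 le_rfl 1 le_rfl).norm_sub_le_of_commutator hk
      (pp (m + 1) (by omega)) (pp (m + 2) (by omega)) (cp (m + 2) (by omega)) (nW _ (by omega))
      (hXoff m hm.le) (hXoff (m + 1) hm) (hXcomm m hm.le) (hXcomm (m + 1) hm)).trans ?_
    refine add_le_add ?_ ?_
    · gcongr
      · exact (np (m + 1) hm).trans (zD _ hm)
      · exact nX0 m hm.le
    · rw [mul_add]
      refine add_le_add (nYdiff m hm) ?_
      calc _ ≤ gapConst (Δ 1 (m + 1)) * (c 1 (m + 1) / T *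
            (D₂ (z m) + 2 * (gapConst (Δ 1 (m + 1)) * D₂ (z m)))) := by
            gcongr
            · exact d1 (m + 1) (by omega)
            · exact nY m hm.le
            · exact nX1 m hm
        _ = c 1 (m + 1) / T * (gapConst (Δ 1 (m + 1)) + 2 * gapConst (Δ 1 (m + 1)) ^ 2)
            * D₂ (z m) := by ring
        _ ≤ c 1 (m + 1) / T * (4 / (Real.pi * (1 - Real.cos (Δ 1 (m + 1) / 2)))) * D₂ (z m) := by
            gcongr
            exact gapConst_add_sq_le hd hdpi
        _ = _ := by
            have := one_sub_cos_half_pos hd hdpi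
            field_simp
  have hstep : ∀ m < N, ‖1 - v m‖ + ‖X (m + 2)‖ * ‖V m - 1‖
      + 2 * ‖V (m + 1) - 1‖ * ‖X (m + 1)‖ + ‖X (m + 2) - X (m + 1)‖ ≤
      4 * (1 / Δ 0 (m + 2) + 2 / Δ 0 (m + 1)) * D₂ (z (m + 1)) * D₂ (z m)
      + 4 * G₃ T c Δ m / ((T : ℝ) ^ 2 * Δ 1 (m + 1))
      + 4 * c 1 (m + 1) / (Real.pi * T * (1 - Real.cos (Δ 1 (m + 1) / 2))) * D₂ (z m)
      + 24 * c 1 m ^ 2 / ((T : ℝ) ^ 2 * Δ 1 m ^ 2) := fun m hm => by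
    have hd0 := pos 0 (by omega) (m + 1) (by omega)
    have hd0' := pos 0 (by omega) (m + 2) (by omega)
    have hd1 := pos 1 (by omega) m (by omega)
    have hD0 : 0 ≤ D₂ (z m) := (z0 m hm.le).trans (zD m hm.le)
    have hD1 : 0 ≤ D₂ (z (m + 1)) := (z0 _ hm).trans (zD _ hm)
    -- The second-order defect of v is at most z², while this summand of the bound equals 6z².
    have s1 : ‖1 - v m‖ ≤ 24 * c 1 m ^ 2 / ((T : ℝ) ^ 2 * Δ 1 m ^ 2) := by
      have e : 24 * c 1 m ^ 2 / ((T : ℝ) ^ 2 * Δ 1 m ^ 2) = 6 * z m ^ 2 := by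
        simp only [hz]
        field_simp
        ring
      rw [e]
      linarith [nv m hm.le, sq_nonneg (z m)]
    have s2 : ‖X (m + 2)‖ * ‖V m - 1‖ ≤ 2 / Δ 0 (m + 2) * D₂ (z (m + 1)) * D₂ (z m) :=
      mul_le_mul (nX0 (m + 1) hm) (nV m hm.le) (norm_nonneg _) (by positivity)
    have s3 : 2 * ‖V (m + 1) - 1‖ * ‖X (m + 1)‖
        ≤ 2 * D₂ (z (m + 1)) * (2 / Δ 0 (m + 1) * D₂ (z m)) := by
      gcongr
      · exact nV (m + 1) hm
      · exact nX0 m hm.le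
    have s4 : 0 ≤ 2 / Δ 0 (m + 2) * D₂ (z (m + 1)) * D₂ (z m) := by positivity
    have e : 4 * (1 / Δ 0 (m + 2) + 2 / Δ 0 (m + 1)) * D₂ (z (m + 1)) * D₂ (z m)
        = 2 * (2 / Δ 0 (m + 2) * D₂ (z (m + 1)) * D₂ (z m))
          + 2 * (2 * D₂ (z (m + 1)) * (2 / Δ 0 (m + 1) * D₂ (z m))) := by ring
    rw [e]
    linarith [nXdiff m hm]
  have main := norm_evolution_sub_evolution_le (N := N) (W := W) (V := V) (v := v) (Y := Y) (X := X)
    (fun m hm => hW m (by omega)) uV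
    (fun m hm => star_opV (pp _ (by omega)) (pp _ (by omega)) (np m hm) (z1 m hm))
    (fun m hm => hXcomm m hm.le)
  have hsum := Finset.sum_le_sum fun m hm => hstep m (Finset.mem_range.mp hm)
  simp only [Finset.sum_add_distrib] at hsum
  have b1 : ‖X 1‖ ≤ 4 / Δ 0 1 * D₂ (z 0) := by
    have := pos 0 (by omega) 1 (by omega)
    have hD0 : 0 ≤ D₂ (z 0) := (z0 0 (by omega)).trans (zD 0 (by omega))
    refine (nX0 0 (by omega)).trans ?_
    gcongr
    norm_num
  have b2 : ‖X (N + 1)‖ ≤ 4 / Δ 0 (N + 1) * D₂ (z N) := by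
    have := pos 0 (by omega) (N + 1) (by omega)
    have hD0 : 0 ≤ D₂ (z N) := (z0 N le_rfl).trans (zD N le_rfl)
    refine (nX0 N le_rfl).trans ?_
    gcongr
    norm_num
  have b3 : ‖V N - 1‖ ≤ 2 * D₂ (z N) := by
    linarith [nV N le_rfl, z0 N le_rfl, zD N le_rfl]
  -- The sum with `G₄` and the last sum of the bound are pure slack: only their nonnegativity
  -- enters.
  have b4 : 0 ≤ ∑ m ∈ Finset.range N, 4 * G₄ T c Δ m / (T * Δ 0 (m + 1)) * D₂ (z m) := by
    refine Finset.sum_nonneg fun m hm => ?_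
    have hm' := Finset.mem_range.mp hm
    have hd0 := pos 0 (by omega) (m + 1) (by omega)
    have hD0 : 0 ≤ D₂ (z m) := (z0 m hm'.le).trans (zD m hm'.le)
    have h3 : 0 ≤ G₃ T c Δ m := (mul_nonneg (hD m hm') (hG₁ m hm')).trans (hG₃ m hm')
    have h4 : 0 ≤ G₄ T c Δ m := add_nonneg (div_nonneg h3 hT0.le) (c1 m (by omega))
    positivity
  have b5 : ∑ m ∈ Finset.range N, 24 * c 1 m ^ 2 / ((T : ℝ) ^ 2 * Δ 1 m ^ 2)
      ≤ ∑ m ∈ Finset.range (N + 1), 24 * c 1 m ^ 2 / ((T : ℝ) ^ 2 * Δ 1 m ^ 2) := by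
    rw [Finset.sum_range_succ]
    exact le_add_of_nonneg_right (by positivity)
  have b6 : 0 ≤ ∑ m ∈ Finset.range (N + 1), 4 * c 1 m ^ 2 / ((T : ℝ) ^ 2 * Δ 1 m ^ 2)
      * (1 - z m)⁻¹ := by
    refine Finset.sum_nonneg fun m hm => mul_nonneg (by positivity) ?_
    exact inv_nonneg.mpr (by linarith [z1 m (Nat.lt_succ_iff.mp (Finset.mem_range.mp hm))])
  simp only [sum_Icc_one_eq_sum_range, Nat.add_sub_cancel]
  refine main.trans ?_
  simp only [Finset.sum_add_distrib]
  linarith
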